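/- Let $\lambda>-1/2$, $w_\lambda(t)=(1-t^2)^{\lambda-1/2}$ on $[-1,1]$, and let all functions be real valued. Let $C_n^\lambda$ ($n\ge 0$) be the Gegenbauer polynomials (for $\lambda=0$: the Chebyshev polynomials of the first kind), which are orthogonal with respect to $w_\lambda$ and satisfy $D_\lambda C_n^\lambda=-n(n+2\lambda)C_n^\lambda$ for $D_\lambda=(1-t^2)\frac{d^2}{dt^2}-(2\lambda+1)t\frac{d}{dt}$. For $f\in L^2(w_\lambda,[-1,1])$ let $\widehat f_n^\lambda$ be the coefficients of $f$ in the corresponding orthonormal expansion (orthonormal for the weight $w_\lambda$ normalized to total mass one). For $s>0$ we say that $(-D_\lambda)^s f\in L^2(w_\lambda)$ if there is $g\in L^2(w_\lambda,[-1,1])$ with $\widehat g_n^\lambda=(n(n+2\lambda))^s\widehat f_n^\lambda$ for all $n\ge 0$; this $g$ is then unique almost everywhere and is denoted by $(-D_\lambda)^s f$. For $\alpha>0$ let $W_2^\alpha(w_\lambda)=\{f\in L^2(w_\lambda,[-1,1]) : (-D_\lambda)^{\alpha/2}f\in L^2(w_\lambda)\}$. Consider, for a real constant $C$ and $\alpha\in\{1,2\}$,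 the assertion that $$\int_{-1}^1|f(t)|^2w_\lambda(t)\,dt\le C\int_{-1}^1(1-t)\,\bigl|(-D_\lambda)^{1/2}f(t)\bigr|^2w_\lambda(t)\,dt\qquad(\ast)$$ holds for all $f\in W_2^\alpha(w_\lambda)$ with $\int_{-1}^1 f(t)w_\lambda(t)\,dt=0$. (i) If $\lambda\ne\frac12$, there is a constant $C=C_\lambda>0$ depending only on $\lambda$ for which $(\ast)$ holds for all mean-zero $f\in W_2^1(w_\lambda)$ (and hence also for all mean-zero $f\in W_2^2(w_\lambda)$). (ii) If $0\le\lambda\le1$ and $\lambda\neq\frac12$, then $C_\lambda=\frac{8}{(2\lambda-1)^2}$ is the optimal constant: for $\alpha=1$, and also for $\alpha=2$, it is the smallest real $C$ for which $(\ast)$ holds for all mean-zero $f\in W_2^\alpha(w_\lambda)$. (iii) If $\lambda=\frac12$, then for $\alpha=1$, and also for $\alpha=2$, there is no real constant $C$ for which $(\ast)$ holds for all mean-zero $f\in W_2^\alpha(w_\lambda)$. -/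

import Mathlib

open MeasureTheory Polynomial

noncomputable section

namespace Gegenbauer

/-- The polynomials `C_n^lam` given by `C_0 = 1`, `C_1 = 2 lam t` and
`(n+2) C_{n+2} = 2 (n+1+lam) t C_{n+1} - (n+2 lam) C_n`. They vanish for `n ≥ 1` if `lam = 0`. -/
def polyAux (lam : ℝ) : ℕ → ℝ[X]
  | 0 => 1
  | 1 => C (2 * lam) * X
  | n + 2 => C (1 / ((n : ℝ) + 2)) *
      (C (2 * ((n : ℝ) + 1 + lam)) * X * polyAux lam (n + 1) - C ((n : ℝ) + 2 * lam) * polyAux lam n)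

/-- The Gegenbauer polynomial `C_n^lam`; for `lam = 0` these are, as usual, the Chebyshev
polynomials of the first kind. -/
def poly (lam : ℝ) (n : ℕ) : ℝ[X] :=
  if lam = 0 then Chebyshev.T ℝ (n : ℤ) else polyAux lam n

/-- The differential operator `D_lam = (1 - t^2) d^2/dt^2 - (2 lam + 1) t d/dt`. -/
def diffOp (lam : ℝ) (f : ℝ → ℝ) (t : ℝ) : ℝ :=
  (1 - t ^ 2) * deriv (deriv f) t - (2 * lam + 1) * t * deriv f t

/-- The eigenvalue `n (n + 2 lam)` of `-D_lam` at `C_n^lam`. -/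
def eigenvalue (lam : ℝ) (n : ℕ) : ℝ := (n : ℝ) * (n + 2 * lam)

lemma polyAux_rec (lam : ℝ) (n : ℕ) :
    C ((n : ℝ) + 2) * polyAux lam (n + 2) =
      C (2 * ((n : ℝ) + 1 + lam)) * X * polyAux lam (n + 1) - C ((n : ℝ) + 2 * lam) * polyAux lam n := by
  rw [polyAux, ← mul_assoc, ← C_mul, mul_one_div_cancel (by positivity), C_1, one_mul]

lemma polyAux_deriv (lam : ℝ) (n : ℕ) :
    derivative (polyAux lam (n + 1)) =
        X * derivative (polyAux lam n) + C ((n : ℝ) + 2 * lam) * polyAux lam n ∧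
      X * derivative (polyAux lam (n + 1)) - derivative (polyAux lam n) =
        C ((n : ℝ) + 1) * polyAux lam (n + 1) := by
  induction n with
  | zero =>
    simp [polyAux]
    ring
  | succ n ih =>
    obtain ⟨hA, hB⟩ := ih
    have hrec := polyAux_rec lam n
    have hd := congrArg derivative hrec
    simp only [derivative_mul, derivative_C, derivative_X, zero_mul, zero_add, mul_one,
      derivative_sub] at hd
    have hne : (C ((n : ℝ) + 2) : ℝ[X]) ≠ 0 := by
      rw [Ne, C_eq_zero]; positivity
    have hA' : derivative (polyAux lam (n + 2)) =
        X * derivative (polyAux lam (n + 1)) + C (((n + 1 : ℕ) : ℝ) + 2 * lam) * polyAux lam (n + 1) := by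
      apply mul_left_cancel₀ hne
      rw [hd]
      push_cast
      simp only [C_add, C_mul, map_natCast, C_1, map_ofNat] at hB ⊢
      linear_combination ((n : ℝ[X]) + 2 * C lam) * hB
    refine ⟨hA', ?_⟩
    rw [hA']
    push_cast
    simp only [C_add, C_mul, map_natCast, C_1, map_ofNat] at hA hB hrec ⊢
    linear_combination X * hB - hrec - hA

/-- `D_lam C_n^lam = - n (n + 2 lam) C_n^lam`. -/
theorem diffOp_poly (lam : ℝ) (n : ℕ) (t : ℝ) :
    diffOp lam (fun x => (poly lam n).eval x) t = - eigenvalue lam n * (poly lam n).eval t := by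
  have key : (1 - X ^ 2) * derivative (derivative (poly lam n)) -
      C (2 * lam + 1) * X * derivative (poly lam n) = - C (eigenvalue lam n) * poly lam n := by
    unfold poly eigenvalue
    split_ifs with h
    · subst h
      have := Chebyshev.one_sub_X_sq_mul_derivative_derivative_T_eq_poly_in_T (R := ℝ) (n : ℤ)
      simp only [Function.iterate_succ, Function.iterate_zero, Function.comp, id] at this
      simp only [mul_zero, zero_add, add_zero, C_1, C_mul, map_natCast]
      push_cast at this
      linear_combination this
    · cases n with
      | zero => simp [polyAux]
      | succ n =>
        obtain ⟨hA, hB⟩ := polyAux_deriv lam n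
        have hA' := congrArg derivative hA
        have hB' := congrArg derivative hB
        simp only [derivative_mul, derivative_C, derivative_X, zero_mul, zero_add, one_mul,
          derivative_add, derivative_sub] at hA' hB'
        push_cast
        simp only [C_add, C_mul, map_natCast, C_1, map_ofNat] at hA hB hA' hB' ⊢
        linear_combination hA' - X * hB' - ((n : ℝ[X]) + 1 + 2 * C lam) * hB
  have hder : ∀ p : ℝ[X], deriv (fun x => p.eval x) = fun x => (derivative p).eval x :=
    fun p => funext fun x => p.deriv
  have := congrArg (eval t) key
  simp only [eval_sub, eval_mul, eval_one, eval_pow, eval_X, eval_C, eval_neg] at this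
  rw [diffOp, hder, hder]
  exact this

/-- The weight `w_lam(t) = (1 - t^2)^(lam - 1/2)`. -/
def weight (lam t : ℝ) : ℝ := (1 - t ^ 2) ^ (lam - 1 / 2)

/-- The measure `w_lam(t) dt` on `[-1, 1]`. -/
def weightMeasure (lam : ℝ) : Measure ℝ :=
  (volume.restrict (Set.Icc (-1) 1)).withDensity fun t => ENNReal.ofReal (weight lam t)

/-- `f` belongs to the (real) space `L^2(w_lam, [-1, 1])`. -/
def MemL2 (lam : ℝ) (f : ℝ → ℝ) : Prop := MemLp f 2 (weightMeasure lam)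

/-- The normalization constant `c_lam = 1 / ∫ w_lam`. -/
def normConst (lam : ℝ) : ℝ := 1 / ∫ t in (-1 : ℝ)..1, weight lam t

/-- `h_n^lam`, the squared norm of `C_n^lam` for the normalized weight `c_lam w_lam`. -/
def normSq (lam : ℝ) (n : ℕ) : ℝ :=
  normConst lam * ∫ t in (-1 : ℝ)..1, (poly lam n).eval t ^ 2 * weight lam t

/-- The coefficient of `f` in its expansion in the orthonormal polynomials
`(h_n^lam)^(-1/2) C_n^lam`. -/
def coeff (lam : ℝ) (f : ℝ → ℝ) (n : ℕ) : ℝ :=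
  (normSq lam n) ^ (-(1 / 2) : ℝ) *
    (normConst lam * ∫ t in (-1 : ℝ)..1, f t * (poly lam n).eval t * weight lam t)

/-- For `s ≠ 0`: the function `g` is in `L^2(w_lam)` and is `(-D_lam)^s f`, that is, its `n`-th
Gegenbauer coefficient is `(n (n + 2 lam))^s` times that of `f` for `n ≥ 1`, and is `0` for `n = 0`
(where the real power `0 ^ s` is `0`). Such a `g` is unique almost everywhere. -/
def IsFracPow (lam s : ℝ) (f g : ℝ → ℝ) : Prop :=
  MemL2 lam g ∧ ∀ n : ℕ, coeff lam g n = eigenvalue lam n ^ s * coeff lam f n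

/-- The Sobolev space `W_2^a(w_lam, [-1, 1])` of all `f` in `L^2(w_lam)` for which
`(-D_lam)^(a/2) f` is in `L^2(w_lam)`. -/
def MemSobolev (lam a : ℝ) (f : ℝ → ℝ) : Prop :=
  MemL2 lam f ∧ ∃ g : ℝ → ℝ, IsFracPow lam (a / 2) f g

/-- The inequality `∫ |f|^2 w_lam ≤ K ∫ (1 - t) |(-D_lam)^(1/2) f|^2 w_lam` holds for all `f` in
`W_2^a(w_lam, [-1, 1])` with `∫ f w_lam = 0`. -/
def HardyRellich (lam a K : ℝ) : Prop :=
  ∀ f g : ℝ → ℝ, MemSobolev lam a f → (∫ t in (-1 : ℝ)..1, f t * weight lam t) = 0 →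
    IsFracPow lam (1 / 2) f g →
    (∫ t in (-1 : ℝ)..1, |f t| ^ 2 * weight lam t) ≤
      K * ∫ t in (-1 : ℝ)..1, (1 - t) * |g t| ^ 2 * weight lam t

end Gegenbauer

end

namespace Gegenbauer

/-! ### The weight and its measure -/

/-! In the orthonormal Gegenbauer basis multiplication by `t` is a Jacobi matrix with zero diagonal
and off-diagonal entries `jacobi lam n`. Writing `x n` for coefficient `n + 1` of `g` (coefficient
`0` vanishes), the inequality says that `∑ x n ^ 2 / eigenvalue lam (n + 1)` is at most `K` times `∑
(x n ^ 2 - 2 * jacobi lam (n + 1) * x n * x (n + 1))`: a discrete Hardy inequality for `1 - t` with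
the first row and column removed. The Sobolev index plays no role. The upper bound uses only `g` in
`L²`, and finite expansions, which lie in every Sobolev space, suffice for the lower bound.

Upper bound (`mul_sum_div_eigenvalue_le`): each cross term is bounded by a weighted AM-GM
inequality, with weights whose product is `4 * jacobi ^ 2`. What remains on the diagonal is of order
`(lam - 1/2)² / (2 n²)`, against eigenvalues of order `n²`. This gives some constant when `lam ≠
1/2`, and `8 / (2 lam - 1)²` when `0 ≤ lam ≤ 1`.

Lower bound (`HardyRellich.one_le_mul`): equality in every AM-GM step determines a ground state
whose squares grow like `n`, so its mass against `1 / eigenvalue` diverges logarithmically.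
Multiplying it by a logarithmic cutoff makes the mass arbitrarily large, while the energy exceeds
`(lam - 1/2)² / 2` times the mass by a bounded amount only (`energy_ground_le`). Hence `1 ≤ K (lam -
1/2)² / 2`. This is optimality, and at `lam = 1/2` it reads `1 ≤ 0`, so no constant exists. -/

lemma weight_nonneg (lam : ℝ) {t : ℝ} (ht : t ∈ Set.Icc (-1 : ℝ) 1) : 0 ≤ weight lam t :=
  Real.rpow_nonneg (by nlinarith [ht.1, ht.2]) _

lemma weight_pos (lam : ℝ) {t : ℝ} (ht : t ∈ Set.Ioo (-1 : ℝ) 1) : 0 < weight lam t :=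
  Real.rpow_pos_of_pos (by nlinarith [ht.1, ht.2]) _

lemma measurable_weight (lam : ℝ) : Measurable (weight lam) := by
  unfold weight
  fun_prop

lemma intervalIntegrable_weight {lam : ℝ} (hlam : -1 / 2 < lam) :
    IntervalIntegrable (weight lam) volume (-1) 1 := by
  have h0 : IntervalIntegrable (fun t : ℝ => t ^ (lam - 1 / 2)) volume 0 1 :=
    intervalIntegral.intervalIntegrable_rpow' (by linarith)
  -- The weight factors as `(1 - t)^(lam - 1/2) * (1 + t)^(lam - 1/2)`. On `[0, 1]` only the first
  -- factor can be singular, and evenness covers `[-1, 0]`.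
  have h1 : IntervalIntegrable (fun t : ℝ => (1 - t) ^ (lam - 1 / 2)) volume 0 1 := by
    simpa using (h0.comp_sub_left 1).symm
  have h2 : ContinuousOn (fun t : ℝ => (1 + t) ^ (lam - 1 / 2)) (Set.uIcc 0 1) := by
    refine ContinuousOn.rpow_const (by fun_prop) fun t ht => Or.inl ?_
    rw [Set.uIcc_of_le zero_le_one] at ht
    linarith [ht.1]
  have h3 : IntervalIntegrable (weight lam) volume 0 1 := by
    refine (h1.mul_continuousOn h2).congr fun t ht => ?_
    rw [Set.uIoc_of_le zero_le_one] at ht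
    simp only [weight]
    rw [← Real.mul_rpow (by linarith [ht.2]) (by linarith [ht.1])]
    congr 1
    ring
  have h4 : IntervalIntegrable (weight lam) volume (-1) 0 := by
    have := (h3.comp_mul_left (c := -1)).symm
    have e : (fun x => weight lam (-x)) = weight lam := by
      ext x
      simp [weight]
    simpa [e] using this
  exact h4.trans h3

lemma integral_weightMeasure (lam : ℝ) (h : ℝ → ℝ) :
    ∫ t, h t ∂weightMeasure lam = ∫ t in (-1 : ℝ)..1, h t * weight lam t := by
  rw [weightMeasure, integral_withDensity_eq_integral_toReal_smul
    (measurable_weight lam).ennreal_ofReal (by simp),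
    intervalIntegral.integral_of_le (by norm_num), ← integral_Icc_eq_integral_Ioc]
  refine setIntegral_congr_fun measurableSet_Icc fun t ht => ?_
  simp only [smul_eq_mul]
  rw [ENNReal.toReal_ofReal (weight_nonneg lam ht), mul_comm]

lemma isFiniteMeasure_weightMeasure {lam : ℝ} (hlam : -1 / 2 < lam) :
    IsFiniteMeasure (weightMeasure lam) := by
  refine isFiniteMeasure_withDensity_ofReal ?_
  have := (intervalIntegrable_iff_integrableOn_Icc_of_le (by norm_num)).1
    (intervalIntegrable_weight hlam)
  exact this.2

lemma ae_mem_Icc_weightMeasure (lam : ℝ) :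
    ∀ᵐ t ∂weightMeasure lam, t ∈ Set.Icc (-1 : ℝ) 1 :=
  (withDensity_absolutelyContinuous _ _).ae_le (ae_restrict_mem measurableSet_Icc)

lemma memLp_of_continuous {lam : ℝ} (hlam : -1 / 2 < lam) {h : ℝ → ℝ} (hh : Continuous h)
    (p : ENNReal) : MemLp h p (weightMeasure lam) := by
  have := isFiniteMeasure_weightMeasure hlam
  obtain ⟨B, hB⟩ := isCompact_Icc.exists_bound_of_continuousOn (s := Set.Icc (-1 : ℝ) 1)
    hh.continuousOn
  exact MemLp.of_bound hh.aestronglyMeasurable B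
    ((ae_mem_Icc_weightMeasure lam).mono fun t ht => hB t ht)

lemma memLp_eval {lam : ℝ} (hlam : -1 / 2 < lam) (p : ℝ[X]) (q : ENNReal) :
    MemLp (fun t => p.eval t) q (weightMeasure lam) :=
  memLp_of_continuous hlam p.continuous q

lemma integrable_eval {lam : ℝ} (hlam : -1 / 2 < lam) (p : ℝ[X]) :
    Integrable (fun t => p.eval t) (weightMeasure lam) :=
  memLp_one_iff_integrable.1 (memLp_eval hlam p 1)

/-- The integral of a nonzero square against the Gegenbauer weight is positive. -/
lemma integral_eval_sq_pos {lam : ℝ} (hlam : -1 / 2 < lam) {p : ℝ[X]} (hp : p ≠ 0) :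
    0 < ∫ t, p.eval t ^ 2 ∂weightMeasure lam := by
  have hint : Integrable (fun t => p.eval t ^ 2) (weightMeasure lam) := by
    have h := integrable_eval hlam (p ^ 2)
    simp only [eval_pow] at h
    exact h
  have hnn : (0 : ℝ → ℝ) ≤ fun t => p.eval t ^ 2 := fun t => sq_nonneg (p.eval t)
  rw [integral_pos_iff_support_of_nonneg hnn hint, pos_iff_ne_zero]
  intro h0
  have h1 : ∀ᵐ t ∂weightMeasure lam, p.eval t = 0 := by
    have : ∀ᵐ t ∂weightMeasure lam, t ∉ Function.support fun t => p.eval t ^ 2 :=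
      measure_eq_zero_iff_ae_notMem.1 h0
    filter_upwards [this] with t ht
    simpa using ht
  rw [weightMeasure, ae_withDensity_iff (measurable_weight lam).ennreal_ofReal,
    ae_restrict_iff' measurableSet_Icc] at h1
  -- A nonzero polynomial has finitely many roots, which cannot exhaust `(-1, 1)` up to a null set.
  have h2 : volume (Set.Ioo (-1 : ℝ) 1 \ (p.roots.toFinset : Set ℝ)) = 0 := by
    refine measure_mono_null ?_ h1
    rintro t ⟨ht, hr⟩ hcon
    have := hcon ⟨ht.1.le, ht.2.le⟩ (by simpa using weight_pos lam ht)
    exact hr (by simp [hp, this])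
  rw [measure_sdiff_null (Finset.measure_zero _ _)] at h2
  norm_num at h2

/-! ### Density of the polynomials -/

/-- The polynomials are dense in `L²(w_lam)`. -/
lemma exists_polynomial_eLpNorm_sub_le {lam : ℝ} (hlam : -1 / 2 < lam) {h : ℝ → ℝ}
    (hh : MemL2 lam h) {ε : ENNReal} (hε : ε ≠ 0) :
    ∃ p : ℝ[X], eLpNorm (h - fun t => p.eval t) 2 (weightMeasure lam) ≤ ε := by
  have := isFiniteMeasure_weightMeasure hlam
  obtain ⟨g, hg, hg2⟩ := MemLp.exists_boundedContinuous_eLpNorm_sub_le (by norm_num) hh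
    (ε := ε / 2) (by simpa using hε)
  set V : ENNReal := weightMeasure lam Set.univ ^ (2 : ENNReal).toReal⁻¹ with hV
  have hVtop : V ≠ ⊤ := ENNReal.rpow_ne_top_of_nonneg (by positivity) (measure_ne_top _ _)
  obtain ⟨δ, hδ, hδε⟩ : ∃ δ : ℝ, 0 < δ ∧ V * ENNReal.ofReal δ ≤ ε / 2 := by
    by_cases hV0 : V = 0
    · exact ⟨1, one_pos, by simp [hV0]⟩
    · have hpos : 0 < min 1 (ε / 2 / V) := by
        refine lt_min one_pos (ENNReal.div_pos (by simpa using hε) hVtop)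
      have htop : min 1 (ε / 2 / V) ≠ ⊤ := ne_top_of_le_ne_top ENNReal.one_ne_top (min_le_left _ _)
      refine ⟨(min 1 (ε / 2 / V)).toReal, ENNReal.toReal_pos hpos.ne' htop, ?_⟩
      rw [ENNReal.ofReal_toReal htop, mul_comm]
      calc min 1 (ε / 2 / V) * V ≤ ε / 2 / V * V := by gcongr; exact min_le_right _ _
        _ = ε / 2 := ENNReal.div_mul_cancel hV0 hVtop
  obtain ⟨p, hp⟩ := exists_polynomial_near_of_continuousOn (-1) 1 g g.continuous.continuousOn δ hδ
  refine ⟨p, ?_⟩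
  have h1 : eLpNorm (⇑g - fun t => p.eval t) 2 (weightMeasure lam) ≤ ε / 2 := by
    refine (eLpNorm_le_of_ae_bound (C := δ) ?_).trans hδε
    filter_upwards [ae_mem_Icc_weightMeasure lam] with t ht
    rw [Pi.sub_apply, Real.norm_eq_abs, abs_sub_comm]
    exact (hp t ht).le
  calc eLpNorm (h - fun t => p.eval t) 2 (weightMeasure lam)
      = eLpNorm ((h - ⇑g) + (⇑g - fun t => p.eval t)) 2 (weightMeasure lam) := by
        rw [sub_add_sub_cancel]
    _ ≤ eLpNorm (h - ⇑g) 2 (weightMeasure lam) +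
          eLpNorm (⇑g - fun t => p.eval t) 2 (weightMeasure lam) :=
        eLpNorm_add_le (hh.1.sub hg2.1) (hg2.1.sub p.continuous.aestronglyMeasurable)
          (by norm_num)
    _ ≤ ε / 2 + ε / 2 := add_le_add hg h1
    _ = ε := ENNReal.add_halves ε

/-! ### Integration by parts -/

/-- `∫ ((1 - t²) r' - (2 lam + 1) t r) w_lam = 0`: the integrand is the derivative of
`(1 - t²)^(lam + 1/2) r`. -/
lemma integral_parts {lam : ℝ} (hlam : -1 / 2 < lam) (r : ℝ[X]) :
    ∫ t, ((1 - X ^ 2) * derivative r - C (2 * lam + 1) * X * r).eval t ∂weightMeasure lam = 0 := by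
  rw [integral_weightMeasure]
  have hpos : 0 < lam + 1 / 2 := by linarith
  have hcont : ContinuousOn (fun t : ℝ => (1 - t ^ 2) ^ (lam + 1 / 2) * r.eval t)
      (Set.Icc (-1) 1) := by
    refine ContinuousOn.mul ?_ r.continuous.continuousOn
    exact ContinuousOn.rpow_const (by fun_prop) fun t _ => Or.inr hpos.le
  have hder : ∀ t ∈ Set.Ioo (-1 : ℝ) 1,
      HasDerivAt (fun t : ℝ => (1 - t ^ 2) ^ (lam + 1 / 2) * r.eval t)
        (((1 - X ^ 2) * derivative r - C (2 * lam + 1) * X * r).eval t * weight lam t) t := by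
    intro t ht
    have hp : 0 < 1 - t ^ 2 := by nlinarith [ht.1, ht.2]
    have h1 : HasDerivAt (fun t : ℝ => 1 - t ^ 2) (-(2 * t)) t := by
      simpa using (hasDerivAt_pow 2 t).const_sub 1
    have h2 := (h1.rpow_const (p := lam + 1 / 2) (Or.inl hp.ne')).mul (r.hasDerivAt t)
    refine h2.congr_deriv ?_
    have e1 : (1 - t ^ 2) ^ (lam + 1 / 2) = (1 - t ^ 2) * weight lam t := by
      rw [weight, ← Real.rpow_one_add' hp.le (by linarith)]
      congr 1
      ring
    have e2 : (1 - t ^ 2) ^ (lam + 1 / 2 - 1) = weight lam t := by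
      rw [weight]
      congr 1
      ring
    rw [e1, e2]
    simp only [eval_sub, eval_mul, eval_one, eval_pow, eval_X, eval_C]
    ring
  have hint : IntervalIntegrable
      (fun t => ((1 - X ^ 2) * derivative r - C (2 * lam + 1) * X * r).eval t * weight lam t)
      volume (-1) 1 :=
    (intervalIntegrable_weight hlam).continuousOn_mul (Polynomial.continuous _).continuousOn
  rw [intervalIntegral.integral_eq_sub_of_hasDerivAt_of_le (by norm_num) hcont hder hint]
  norm_num [Real.zero_rpow hpos.ne']
/-! ### Orthogonality and the three-term recurrence -/

lemma diffOp_poly_polynomial (lam : ℝ) (n : ℕ) :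
    (1 - X ^ 2) * derivative (derivative (poly lam n)) -
      C (2 * lam + 1) * X * derivative (poly lam n) = - C (eigenvalue lam n) * poly lam n := by
  refine Polynomial.funext fun t => ?_
  have h := diffOp_poly lam n t
  have hder : ∀ p : ℝ[X], deriv (fun x => p.eval x) = fun x => (derivative p).eval x :=
    fun p => funext fun x => p.deriv
  rw [diffOp, hder, hder] at h
  simpa using h

lemma eigenvalue_strictMono {lam : ℝ} (hlam : -1 / 2 < lam) : StrictMono (eigenvalue lam) := by
  refine strictMono_nat_of_lt_succ fun n => ?_
  simp only [eigenvalue]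
  push_cast
  nlinarith [(Nat.cast_nonneg n : (0 : ℝ) ≤ n)]

lemma eigenvalue_pos {lam : ℝ} (hlam : -1 / 2 < lam) {n : ℕ} (hn : n ≠ 0) :
    0 < eigenvalue lam n := by
  have := eigenvalue_strictMono hlam (Nat.pos_of_ne_zero hn)
  simpa [eigenvalue] using this

/-- Applying `integral_parts` to the Wronskian of the two polynomials leaves the difference of their
eigenvalues times the integral of the product, and the eigenvalues are distinct. -/
lemma integral_poly_mul_poly {lam : ℝ} (hlam : -1 / 2 < lam) {n m : ℕ} (hnm : n ≠ m) :
    ∫ t, (poly lam n * poly lam m).eval t ∂weightMeasure lam = 0 := by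
  have h := integral_parts hlam
    (derivative (poly lam n) * poly lam m - poly lam n * derivative (poly lam m))
  have e : (1 - X ^ 2) * derivative (derivative (poly lam n) * poly lam m -
        poly lam n * derivative (poly lam m)) - C (2 * lam + 1) * X *
        (derivative (poly lam n) * poly lam m - poly lam n * derivative (poly lam m)) =
      C (eigenvalue lam m - eigenvalue lam n) * (poly lam n * poly lam m) := by
    simp only [derivative_sub, derivative_mul, C_sub]
    linear_combination poly lam m * diffOp_poly_polynomial lam n -
      poly lam n * diffOp_poly_polynomial lam m
  rw [e] at h
  simp only [eval_mul, eval_C] at h ⊢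
  rw [integral_const_mul] at h
  refine (mul_eq_zero.1 h).resolve_left fun h0 => hnm ?_
  exact (eigenvalue_strictMono hlam).injective (sub_eq_zero.1 h0).symm

/-- The coefficient of `C_{n+1}` in `t C_n`, for `n ≥ 1`. -/
noncomputable def recUp (lam : ℝ) (n : ℕ) : ℝ :=
  if lam = 0 then 1 / 2 else ((n : ℝ) + 1) / (2 * (n + lam))

/-- The coefficient of `C_{n-1}` in `t C_n`, for `n ≥ 2`. -/
noncomputable def recDown (lam : ℝ) (n : ℕ) : ℝ :=
  if lam = 0 then 1 / 2 else ((n : ℝ) - 1 + 2 * lam) / (2 * (n + lam))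

/-- The index starts at `n + 1` because `t T_0 = T_1` has coefficient `1`, not the `1/2` of `recUp`
at `lam = 0`. -/
lemma X_mul_poly {lam : ℝ} (hlam : -1 / 2 < lam) (n : ℕ) :
    X * poly lam (n + 1) = C (recUp lam (n + 1)) * poly lam (n + 2) +
      C (recDown lam (n + 1)) * poly lam n := by
  unfold recUp recDown poly
  split_ifs with h
  · have h2 := Chebyshev.T_add_two ℝ (n : ℤ)
    have h3 : (C (1 / 2) * 2 : ℝ[X]) = 1 := by
      rw [← map_ofNat C 2, ← C_mul]
      norm_num
    push_cast
    rw [h2]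
    linear_combination -(X * Chebyshev.T ℝ ((n : ℤ) + 1)) * h3
  · have hne : (2 * ((n : ℝ) + 1 + lam)) ≠ 0 := by
      have : (0 : ℝ) ≤ n := Nat.cast_nonneg n
      linarith
    apply mul_left_cancel₀ (C_ne_zero.2 hne)
    have hrec := polyAux_rec lam n
    have e1 : C (2 * ((n : ℝ) + 1 + lam)) *
        C ((((n + 1 : ℕ) : ℝ) + 1) / (2 * (((n + 1 : ℕ) : ℝ) + lam))) = C ((n : ℝ) + 2) := by
      rw [← C_mul]
      push_cast
      rw [mul_div_cancel₀ _ hne]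
      congr 1
      ring
    have e2 : C (2 * ((n : ℝ) + 1 + lam)) *
        C ((((n + 1 : ℕ) : ℝ) - 1 + 2 * lam) / (2 * (((n + 1 : ℕ) : ℝ) + lam))) =
          C ((n : ℝ) + 2 * lam) := by
      rw [← C_mul]
      push_cast
      rw [mul_div_cancel₀ _ hne]
      congr 1
      ring
    linear_combination -hrec - polyAux lam (n + 2) * e1 - polyAux lam n * e2

lemma poly_zero (lam : ℝ) : poly lam 0 = 1 := by
  unfold poly
  split_ifs <;> simp [polyAux]

lemma exists_X_eq_poly_one (lam : ℝ) : ∃ a : ℝ, X = C a * poly lam 1 := by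
  unfold poly
  split_ifs with h
  · exact ⟨1, by simp⟩
  · refine ⟨(2 * lam)⁻¹, ?_⟩
    rw [polyAux, ← mul_assoc, ← C_mul, inv_mul_cancel₀ (by simpa using h), C_1, one_mul]

lemma eval_one_polyAux_ne_zero {lam : ℝ} (hlam : -1 / 2 < lam) (h0 : lam ≠ 0) (n : ℕ) :
    (polyAux lam n).eval 1 ≠ 0 := by
  induction n with
  | zero => simp [polyAux]
  | succ n ih =>
    obtain ⟨hA, hB⟩ := polyAux_deriv lam n
    have hA' := congrArg (eval 1) hA
    have hB' := congrArg (eval 1) hB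
    simp only [eval_add, eval_sub, eval_mul, eval_X, eval_C, one_mul] at hA' hB'
    have key : ((n : ℝ) + 1) * (polyAux lam (n + 1)).eval 1 =
        ((n : ℝ) + 2 * lam) * (polyAux lam n).eval 1 := by linarith
    intro hz
    rw [hz, mul_zero] at key
    refine mul_ne_zero ?_ ih key.symm
    rcases n with _ | n
    · simpa using h0
    · push_cast
      have : (0 : ℝ) ≤ n := Nat.cast_nonneg n
      linarith

lemma poly_ne_zero {lam : ℝ} (hlam : -1 / 2 < lam) (n : ℕ) : poly lam n ≠ 0 := by
  intro h
  have h1 := congrArg (eval 1) h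
  unfold poly at h1
  split_ifs at h1 with h0
  · simp at h1
  · exact eval_one_polyAux_ne_zero hlam h0 n (by simpa using h1)

/-- Every polynomial is a combination of Gegenbauer polynomials. -/
lemma span_poly {lam : ℝ} (hlam : -1 / 2 < lam) :
    Submodule.span ℝ (Set.range (poly lam)) = ⊤ := by
  set S := Submodule.span ℝ (Set.range (poly lam)) with hS
  have hmem : ∀ n, poly lam n ∈ S := fun n => Submodule.subset_span ⟨n, rfl⟩
  have hX : ∀ p ∈ S, X * p ∈ S := by
    intro p hp
    induction hp using Submodule.span_induction with
    | mem p hp =>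
      obtain ⟨n, rfl⟩ := hp
      rcases n with _ | n
      · obtain ⟨a, ha⟩ := exists_X_eq_poly_one lam
        rw [poly_zero, mul_one, ha, ← smul_eq_C_mul]
        exact S.smul_mem _ (hmem 1)
      · rw [X_mul_poly hlam, ← smul_eq_C_mul, ← smul_eq_C_mul]
        exact S.add_mem (S.smul_mem _ (hmem _)) (S.smul_mem _ (hmem _))
    | zero => simp
    | add p q _ _ hp hq =>
      rw [mul_add]
      exact S.add_mem hp hq
    | smul a p _ hp =>
      rw [mul_smul_comm]
      exact S.smul_mem _ hp
  rw [eq_top_iff]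
  rintro p -
  induction p using Polynomial.induction_on' with
  | add p q hp hq => exact S.add_mem hp hq
  | monomial n a =>
    rw [← C_mul_X_pow_eq_monomial, ← smul_eq_C_mul]
    refine S.smul_mem _ ?_
    induction n with
    | zero =>
      rw [pow_zero, ← poly_zero lam]
      exact hmem 0
    | succ n ih =>
      rw [pow_succ']
      exact hX _ ih

/-! ### The orthonormal polynomials -/

/-- The polynomials `C_n^lam` normalized in `L²(w_lam)`. -/
noncomputable def orthoPoly (lam : ℝ) (n : ℕ) : ℝ[X] :=
  C (√(∫ t, (poly lam n).eval t ^ 2 ∂weightMeasure lam))⁻¹ * poly lam n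

/-- The off-diagonal Jacobi coefficients. -/
noncomputable def jacobi (lam : ℝ) (n : ℕ) : ℝ :=
  ∫ t, (X * orthoPoly lam n * orthoPoly lam (n + 1)).eval t ∂weightMeasure lam

lemma sqrt_norm_poly_pos {lam : ℝ} (hlam : -1 / 2 < lam) (n : ℕ) :
    0 < √(∫ t, (poly lam n).eval t ^ 2 ∂weightMeasure lam) :=
  Real.sqrt_pos.2 (integral_eval_sq_pos hlam (poly_ne_zero hlam n))

lemma integral_orthoPoly_mul {lam : ℝ} (hlam : -1 / 2 < lam) (n m : ℕ) :
    ∫ t, (orthoPoly lam n * orthoPoly lam m).eval t ∂weightMeasure lam =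
      if n = m then 1 else 0 := by
  have e : ∀ t : ℝ, (orthoPoly lam n * orthoPoly lam m).eval t =
      ((√(∫ t, (poly lam n).eval t ^ 2 ∂weightMeasure lam))⁻¹ *
        (√(∫ t, (poly lam m).eval t ^ 2 ∂weightMeasure lam))⁻¹) *
        (poly lam n * poly lam m).eval t := by
    intro t
    simp only [orthoPoly, eval_mul, eval_C]
    ring
  simp only [e]
  rw [integral_const_mul]
  split_ifs with h
  · subst h
    have hpos := integral_eval_sq_pos hlam (poly_ne_zero hlam n)
    simp only [eval_mul]
    simp only [← pow_two]
    rw [inv_pow, Real.sq_sqrt hpos.le, inv_mul_cancel₀ hpos.ne']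
  · rw [integral_poly_mul_poly hlam h, mul_zero]


/-- Each Jacobi coefficient arises twice, from the upward and from the downward part of the
recurrence. In the product of the two expressions the norms cancel, so `jacobi_succ_sq` needs no
explicit value of them. -/
lemma X_mul_orthoPoly_aux {lam : ℝ} (hlam : -1 / 2 < lam) (n : ℕ) :
    jacobi lam (n + 1) = recUp lam (n + 1) *
      √(∫ t, (poly lam (n + 2)).eval t ^ 2 ∂weightMeasure lam) /
      √(∫ t, (poly lam (n + 1)).eval t ^ 2 ∂weightMeasure lam) ∧
    jacobi lam n = recDown lam (n + 1) *
      √(∫ t, (poly lam n).eval t ^ 2 ∂weightMeasure lam) /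
      √(∫ t, (poly lam (n + 1)).eval t ^ 2 ∂weightMeasure lam) ∧
    X * orthoPoly lam (n + 1) =
      C (jacobi lam (n + 1)) * orthoPoly lam (n + 2) + C (jacobi lam n) * orthoPoly lam n := by
  set s : ℕ → ℝ := fun n => √(∫ t, (poly lam n).eval t ^ 2 ∂weightMeasure lam) with hs
  have hs0 : ∀ n, s n ≠ 0 := fun n => (sqrt_norm_poly_pos hlam n).ne'
  have hrec : X * orthoPoly lam (n + 1) =
      C (recUp lam (n + 1) * s (n + 2) / s (n + 1)) * orthoPoly lam (n + 2) +
        C (recDown lam (n + 1) * s n / s (n + 1)) * orthoPoly lam n := by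
    have h1 : ∀ k, orthoPoly lam k = C (s k)⁻¹ * poly lam k := fun k => rfl
    rw [h1, h1, h1, mul_left_comm, X_mul_poly hlam, mul_add]
    simp only [← mul_assoc, ← C_mul]
    congr 3
    · have := hs0 (n + 2)
      field_simp
    · have := hs0 n
      field_simp
  have hint : ∀ a b : ℝ, ∀ p q r : ℝ[X],
      ∫ t, ((C a * p + C b * q) * r).eval t ∂weightMeasure lam =
        a * ∫ t, (p * r).eval t ∂weightMeasure lam + b * ∫ t, (q * r).eval t ∂weightMeasure lam := by
    intro a b p q r
    rw [← integral_const_mul, ← integral_const_mul, ← integral_add]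
    · refine integral_congr_ae (Filter.Eventually.of_forall fun t => ?_)
      simp only [eval_mul, eval_add, eval_C]
      ring
    · exact (integrable_eval hlam _).const_mul a
    · exact (integrable_eval hlam _).const_mul b
  have j1 : jacobi lam (n + 1) = recUp lam (n + 1) * s (n + 2) / s (n + 1) := by
    rw [jacobi, hrec, hint, integral_orthoPoly_mul hlam, integral_orthoPoly_mul hlam,
      if_pos rfl, if_neg (by omega), mul_one, mul_zero, add_zero]
  have j2 : jacobi lam n = recDown lam (n + 1) * s n / s (n + 1) := by
    have e : X * orthoPoly lam n * orthoPoly lam (n + 1) =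
      X * orthoPoly lam (n + 1) * orthoPoly lam n := by ring
    rw [jacobi, e, hrec, hint, integral_orthoPoly_mul hlam, integral_orthoPoly_mul hlam]
    simp
  refine ⟨j1, j2, ?_⟩
  rw [j1, j2, hrec]

lemma X_mul_orthoPoly {lam : ℝ} (hlam : -1 / 2 < lam) (n : ℕ) :
    X * orthoPoly lam (n + 1) =
      C (jacobi lam (n + 1)) * orthoPoly lam (n + 2) + C (jacobi lam n) * orthoPoly lam n :=
  (X_mul_orthoPoly_aux hlam n).2.2

lemma jacobi_succ_pos {lam : ℝ} (hlam : -1 / 2 < lam) (n : ℕ) : 0 < jacobi lam (n + 1) := by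
  rw [(X_mul_orthoPoly_aux hlam n).1]
  refine div_pos (mul_pos ?_ (sqrt_norm_poly_pos hlam _)) (sqrt_norm_poly_pos hlam _)
  unfold recUp
  split_ifs
  · norm_num
  · have : (0 : ℝ) ≤ n := Nat.cast_nonneg n
    push_cast
    refine div_pos (by linarith) (by linarith)

lemma jacobi_succ_sq {lam : ℝ} (hlam : -1 / 2 < lam) (n : ℕ) :
    jacobi lam (n + 1) ^ 2 =
      ((n : ℝ) + 2) * (n + 1 + 2 * lam) / (4 * (n + 1 + lam) * (n + 2 + lam)) := by
  have h1 := (X_mul_orthoPoly_aux hlam n).1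
  have h2 := (X_mul_orthoPoly_aux hlam (n + 1)).2.1
  have p1 := (sqrt_norm_poly_pos hlam (n + 1)).ne'
  have p2 := (sqrt_norm_poly_pos hlam (n + 2)).ne'
  have h3 : jacobi lam (n + 1) ^ 2 = recUp lam (n + 1) * recDown lam (n + 2) := by
    rw [pow_two]
    nth_rewrite 1 [h1]
    rw [h2]
    field_simp
  rw [h3]
  have : (0 : ℝ) ≤ n := Nat.cast_nonneg n
  have q1 : (n : ℝ) + 1 + lam ≠ 0 := by linarith
  have q2 : (n : ℝ) + 2 + lam ≠ 0 := by linarith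
  unfold recUp recDown
  split_ifs with h0
  · subst h0
    field_simp
    ring
  · push_cast
    field_simp
    ring
/-! ### The Gegenbauer expansion -/

open Filter Topology

lemma inner_toLp {mu : Measure ℝ} {f g : ℝ → ℝ} (hf : MemLp f 2 mu) (hg : MemLp g 2 mu) :
    inner ℝ (hf.toLp f) (hg.toLp g) = ∫ t, f t * g t ∂mu := by
  rw [L2.inner_def]
  refine integral_congr_ae ?_
  filter_upwards [hf.coeFn_toLp, hg.coeFn_toLp] with t h1 h2
  rw [h1, h2]
  simp [mul_comm]

/-- The normalized Gegenbauer polynomials as elements of `L²(w_lam)`. -/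
noncomputable def orthoLp {lam : ℝ} (hlam : -1 / 2 < lam) (n : ℕ) : Lp ℝ 2 (weightMeasure lam) :=
  (memLp_eval hlam (orthoPoly lam n) 2).toLp _

lemma orthonormal_orthoLp {lam : ℝ} (hlam : -1 / 2 < lam) : Orthonormal ℝ (orthoLp hlam) := by
  rw [orthonormal_iff_ite]
  intro n m
  rw [orthoLp, orthoLp, inner_toLp, ← integral_orthoPoly_mul hlam]
  simp only [eval_mul]

lemma toLp_eval_mem_span {lam : ℝ} (hlam : -1 / 2 < lam) (p : ℝ[X]) :
    (memLp_eval hlam p 2).toLp _ ∈ Submodule.span ℝ (Set.range (orthoLp hlam)) := by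
  have hp : p ∈ Submodule.span ℝ (Set.range (poly lam)) := by
    rw [span_poly hlam]
    trivial
  induction hp using Submodule.span_induction with
  | mem p hp =>
    obtain ⟨n, rfl⟩ := hp
    set s := √(∫ t, (poly lam n).eval t ^ 2 ∂weightMeasure lam) with hs
    have hs0 : s ≠ 0 := (sqrt_norm_poly_pos hlam n).ne'
    have e : (memLp_eval hlam (poly lam n) 2).toLp _ = s • orthoLp hlam n := by
      rw [orthoLp, ← MemLp.toLp_const_smul]
      refine MemLp.toLp_congr _ _ (Eventually.of_forall fun t => ?_)
      simp only [orthoPoly, Pi.smul_apply, smul_eq_mul, eval_mul, eval_C]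
      rw [← hs, ← mul_assoc, mul_inv_cancel₀ hs0, one_mul]
    rw [e]
    exact Submodule.smul_mem _ _ (Submodule.subset_span ⟨n, rfl⟩)
  | zero =>
    convert! Submodule.zero_mem _ using 1
    rw [MemLp.toLp_eq_toLp_iff (memLp_eval hlam 0 2) MemLp.zero |>.2]
    · exact MemLp.toLp_zero _
    · exact Eventually.of_forall fun t => by simp
  | add p q _ _ hp hq =>
    have e : (memLp_eval hlam (p + q) 2).toLp _ =
        (memLp_eval hlam p 2).toLp _ + (memLp_eval hlam q 2).toLp _ := by
      rw [← MemLp.toLp_add]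
      exact MemLp.toLp_congr _ _ (Eventually.of_forall fun t => by simp)
    rw [e]
    exact Submodule.add_mem _ hp hq
  | smul a p _ hp =>
    have e : (memLp_eval hlam (a • p) 2).toLp _ = a • (memLp_eval hlam p 2).toLp _ := by
      rw [← MemLp.toLp_const_smul]
      exact MemLp.toLp_congr _ _ (Eventually.of_forall fun t => by simp)
    rw [e]
    exact Submodule.smul_mem _ _ hp

lemma dense_span_orthoLp {lam : ℝ} (hlam : -1 / 2 < lam) :
    ⊤ ≤ (Submodule.span ℝ (Set.range (orthoLp hlam))).topologicalClosure := by
  rintro f -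
  rw [← SetLike.mem_coe, Submodule.topologicalClosure_coe, EMetric.mem_closure_iff]
  intro ε hε
  obtain ⟨δ, hδ, hδε⟩ := exists_between hε
  obtain ⟨p, hp⟩ := exists_polynomial_eLpNorm_sub_le hlam (Lp.memLp f) hδ.ne'
  refine ⟨_, toLp_eval_mem_span hlam p, lt_of_le_of_lt ?_ hδε⟩
  rw [Lp.edist_def]
  refine le_trans (le_of_eq (eLpNorm_congr_ae ?_)) hp
  filter_upwards [(memLp_eval hlam p 2).coeFn_toLp] with t ht
  simp [ht]

lemma parseval_orthoPoly {lam : ℝ} (hlam : -1 / 2 < lam) {f g : ℝ → ℝ} (hf : MemL2 lam f)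
    (hg : MemL2 lam g) :
    HasSum (fun n => (∫ t, f t * (orthoPoly lam n).eval t ∂weightMeasure lam) *
      ∫ t, g t * (orthoPoly lam n).eval t ∂weightMeasure lam)
      (∫ t, f t * g t ∂weightMeasure lam) := by
  replace hf : MemLp f 2 (weightMeasure lam) := hf
  replace hg : MemLp g 2 (weightMeasure lam) := hg
  have h := (HilbertBasis.mk (orthonormal_orthoLp hlam)
    (dense_span_orthoLp hlam)).hasSum_inner_mul_inner (hf.toLp f) (hg.toLp g)
  rw [HilbertBasis.coe_mk, inner_toLp] at h
  refine h.congr_fun fun n => ?_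
  rw [real_inner_comm (hg.toLp g), orthoLp, inner_toLp, inner_toLp]

lemma normConst_pos {lam : ℝ} (hlam : -1 / 2 < lam) : 0 < normConst lam := by
  have h := integral_eval_sq_pos hlam (one_ne_zero : (1 : ℝ[X]) ≠ 0)
  rw [integral_weightMeasure] at h
  rw [normConst]
  simpa using h

/-- The integral carries one factor `normConst lam` and the square root of `normSq` removes half a
power of it, which leaves the square root. -/
lemma coeff_eq {lam : ℝ} (hlam : -1 / 2 < lam) (f : ℝ → ℝ) (n : ℕ) :
    coeff lam f n = √(normConst lam) *
      ∫ t, f t * (orthoPoly lam n).eval t ∂weightMeasure lam := by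
  have hc := normConst_pos hlam
  have hH := integral_eval_sq_pos hlam (poly_ne_zero hlam n)
  have e : ∀ t, f t * (orthoPoly lam n).eval t =
      (√(∫ t, (poly lam n).eval t ^ 2 ∂weightMeasure lam))⁻¹ * (f t * (poly lam n).eval t) := by
    intro t
    simp only [orthoPoly, eval_mul, eval_C]
    ring
  simp only [e]
  rw [integral_const_mul, coeff, normSq, ← integral_weightMeasure lam fun t => (poly lam n).eval t ^ 2,
    ← integral_weightMeasure lam fun t => f t * (poly lam n).eval t,
    Real.rpow_neg (mul_nonneg hc.le hH.le), ← Real.sqrt_eq_rpow, Real.sqrt_mul hc.le, mul_inv]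
  have hs := Real.mul_self_sqrt hc.le
  have hs0 := (Real.sqrt_pos.2 hc).ne'
  nth_rewrite 2 [← hs]
  field_simp

lemma parseval {lam : ℝ} (hlam : -1 / 2 < lam) {f g : ℝ → ℝ} (hf : MemL2 lam f)
    (hg : MemL2 lam g) :
    HasSum (fun n => coeff lam f n * coeff lam g n)
      (normConst lam * ∫ t, f t * g t ∂weightMeasure lam) := by
  have hs := Real.mul_self_sqrt (normConst_pos hlam).le
  have h := (parseval_orthoPoly hlam hf hg).mul_left (normConst lam)
  refine h.congr_fun fun n => ?_
  rw [coeff_eq hlam, coeff_eq hlam]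
  linear_combination ((∫ t, f t * (orthoPoly lam n).eval t ∂weightMeasure lam) *
    ∫ t, g t * (orthoPoly lam n).eval t ∂weightMeasure lam) * hs

lemma memL2_mul_continuous {lam : ℝ} {g h : ℝ → ℝ} (hg : MemL2 lam g)
    (hh : Continuous h) : MemL2 lam fun t => h t * g t := by
  obtain ⟨B, hB⟩ := isCompact_Icc.exists_bound_of_continuousOn (s := Set.Icc (-1 : ℝ) 1)
    hh.continuousOn
  refine MemLp.of_le_mul (c := B) hg (hh.aestronglyMeasurable.mul hg.1) ?_
  filter_upwards [ae_mem_Icc_weightMeasure lam] with t ht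
  rw [norm_mul]
  exact mul_le_mul_of_nonneg_right (hB t ht) (norm_nonneg _)

lemma integrable_mul_eval {lam : ℝ} (hlam : -1 / 2 < lam) {g : ℝ → ℝ} (hg : MemL2 lam g)
    (p : ℝ[X]) : Integrable (fun t => g t * p.eval t) (weightMeasure lam) :=
  hg.integrable_mul (memLp_eval hlam p 2)

lemma coeff_one_sub_mul {lam : ℝ} (hlam : -1 / 2 < lam) {g : ℝ → ℝ} (hg : MemL2 lam g) (n : ℕ) :
    coeff lam (fun t => (1 - t) * g t) (n + 1) = coeff lam g (n + 1) -
      (jacobi lam (n + 1) * coeff lam g (n + 2) + jacobi lam n * coeff lam g n) := by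
  simp only [coeff_eq hlam]
  have e : ∀ t, (1 - t) * g t * (orthoPoly lam (n + 1)).eval t =
      g t * (orthoPoly lam (n + 1)).eval t -
        (jacobi lam (n + 1) * (g t * (orthoPoly lam (n + 2)).eval t) +
          jacobi lam n * (g t * (orthoPoly lam n).eval t)) := by
    intro t
    have h := congrArg (eval t) (X_mul_orthoPoly hlam n)
    simp only [eval_add, eval_mul, eval_X, eval_C] at h
    linear_combination (-g t) * h
  simp only [e]
  have i := integrable_mul_eval hlam hg
  have i2 : Integrable (fun t => jacobi lam (n + 1) * (g t * (orthoPoly lam (n + 2)).eval t) +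
      jacobi lam n * (g t * (orthoPoly lam n).eval t)) (weightMeasure lam) :=
    ((i _).const_mul _).add ((i _).const_mul _)
  rw [integral_sub (i _) i2,
    integral_add ((i _).const_mul _) ((i _).const_mul _), integral_const_mul, integral_const_mul]
  ring

lemma jacobi_succ_le_one {lam : ℝ} (hlam : -1 / 2 < lam) (n : ℕ) : jacobi lam (n + 1) ≤ 1 := by
  rw [← abs_of_pos (jacobi_succ_pos hlam n), ← sq_le_one_iff_abs_le_one, jacobi_succ_sq hlam]
  have : (0 : ℝ) ≤ n := Nat.cast_nonneg n
  have h1 : 0 < (n : ℝ) + 1 + lam := by linarith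
  have h2 : 0 < (n : ℝ) + 2 + lam := by linarith
  rw [div_le_one (by positivity)]
  nlinarith [mul_nonneg this (by linarith : 0 ≤ lam + 1 / 2), sq_nonneg (lam + 1 / 2)]

/-- The quadratic form `∫ (1 - t) g² w_lam` in terms of the coefficients of `g`. -/
lemma tendsto_energy {lam : ℝ} (hlam : -1 / 2 < lam) {g : ℝ → ℝ} (hg : MemL2 lam g)
    (h0 : coeff lam g 0 = 0) :
    Tendsto (fun N => ∑ n ∈ Finset.range N, (coeff lam g (n + 1) ^ 2 -
        2 * jacobi lam (n + 1) * coeff lam g (n + 1) * coeff lam g (n + 2))) atTop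
      (𝓝 (normConst lam * ∫ t, (1 - t) * g t * g t ∂weightMeasure lam)) := by
  have hsum := parseval hlam (memL2_mul_continuous hg (h := fun t => 1 - t) (by fun_prop)) hg
  have hpart : ∀ N, ∑ n ∈ Finset.range N, (coeff lam g (n + 1) ^ 2 -
        2 * jacobi lam (n + 1) * coeff lam g (n + 1) * coeff lam g (n + 2)) =
      -- Truncating the Parseval sum of `(1 - t) g` against `g` cuts a single off-diagonal pair in
      -- two; the leftover half tends to zero.
      ∑ n ∈ Finset.range (N + 1), coeff lam (fun t => (1 - t) * g t) n * coeff lam g n -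
        jacobi lam N * coeff lam g N * coeff lam g (N + 1) := by
    intro N
    induction N with
    | zero => simp [h0]
    | succ N ih =>
      rw [Finset.sum_range_succ, ih, Finset.sum_range_succ _ (N + 1), coeff_one_sub_mul hlam hg]
      ring
  have hzero : Tendsto (coeff lam g) atTop (𝓝 0) := by
    have h := (parseval hlam hg hg).summable.tendsto_atTop_zero
    have h2 := h.sqrt
    simp only [Real.sqrt_mul_self_eq_abs, Real.sqrt_zero] at h2
    exact (tendsto_zero_iff_abs_tendsto_zero _).2 h2
  have herr : Tendsto (fun N => jacobi lam N * coeff lam g N * coeff lam g (N + 1)) atTop (𝓝 0) := by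
    rw [← tendsto_add_atTop_iff_nat 1]
    have h1 := (tendsto_add_atTop_iff_nat 1).2 hzero
    have h2 := (tendsto_add_atTop_iff_nat 2).2 hzero
    have h3 : Tendsto (fun N => |coeff lam g (N + 1)| * |coeff lam g (N + 2)|) atTop (𝓝 0) := by
      simpa using h1.abs.mul h2.abs
    refine squeeze_zero_norm (fun N => ?_) h3
    rw [norm_mul, norm_mul, Real.norm_eq_abs, Real.norm_eq_abs, Real.norm_eq_abs,
      abs_of_pos (jacobi_succ_pos hlam N)]
    gcongr
    exact mul_le_of_le_one_left (abs_nonneg _) (jacobi_succ_le_one hlam N)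
  have h4 := ((tendsto_add_atTop_iff_nat 1).2 hsum.tendsto_sum_nat).sub herr
  rw [sub_zero] at h4
  exact h4.congr fun N => (hpart N).symm

/-- Every finitely supported sequence is the coefficient sequence of a function. -/
lemma exists_memL2_coeff {lam : ℝ} (hlam : -1 / 2 < lam) (x : ℕ → ℝ) (N : ℕ) :
    ∃ f : ℝ → ℝ, MemL2 lam f ∧ ∀ n, coeff lam f n = if n < N then x n else 0 := by
  set p : ℝ[X] := ∑ k ∈ Finset.range N, C (x k / √(normConst lam)) * orthoPoly lam k with hp
  refine ⟨fun t => p.eval t, memLp_eval hlam p 2, fun n => ?_⟩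
  have hc := (Real.sqrt_pos.2 (normConst_pos hlam)).ne'
  rw [coeff_eq hlam]
  have e : ∀ t, p.eval t * (orthoPoly lam n).eval t = ∑ k ∈ Finset.range N,
      x k / √(normConst lam) * (orthoPoly lam k * orthoPoly lam n).eval t := by
    intro t
    rw [hp, eval_finsetSum, Finset.sum_mul]
    refine Finset.sum_congr rfl fun k _ => ?_
    simp only [eval_mul, eval_C]
    ring
  simp only [e]
  rw [integral_finsetSum _ fun k _ => (integrable_eval hlam _).const_mul _]
  simp only [integral_const_mul, integral_orthoPoly_mul hlam, mul_ite, mul_one, mul_zero]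
  rw [Finset.sum_ite_eq']
  simp only [Finset.mem_range, mul_ite, mul_zero]
  rw [mul_div_cancel₀ _ hc]
/-! ### Reduction to sequences -/

lemma coeff_zero_of_integral_eq_zero {lam : ℝ} {f : ℝ → ℝ}
    (hf : (∫ t in (-1 : ℝ)..1, f t * weight lam t) = 0) : coeff lam f 0 = 0 := by
  simp [coeff, poly_zero, hf]

lemma IsFracPow.coeff_zero {lam : ℝ} {s : ℝ} (hs : s ≠ 0) {f g : ℝ → ℝ}
    (h : IsFracPow lam s f g) : coeff lam g 0 = 0 := by
  rw [h.2 0]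
  simp [eigenvalue, Real.zero_rpow hs]

lemma IsFracPow.coeff_sq {lam : ℝ} (hlam : -1 / 2 < lam) {f g : ℝ → ℝ}
    (h : IsFracPow lam (1 / 2) f g) (n : ℕ) :
    coeff lam g (n + 1) ^ 2 / eigenvalue lam (n + 1) = coeff lam f (n + 1) ^ 2 := by
  have hpos := eigenvalue_pos hlam (Nat.succ_ne_zero n)
  rw [h.2, mul_pow, ← Real.sqrt_eq_rpow, Real.sq_sqrt hpos.le, mul_div_cancel_left₀ _ hpos.ne']

lemma integral_abs_sq (lam : ℝ) (f : ℝ → ℝ) :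
    (∫ t in (-1 : ℝ)..1, |f t| ^ 2 * weight lam t) = ∫ t, f t * f t ∂weightMeasure lam := by
  rw [integral_weightMeasure]
  simp only [sq_abs]
  simp only [pow_two]

lemma integral_one_sub_abs_sq (lam : ℝ) (g : ℝ → ℝ) :
    (∫ t in (-1 : ℝ)..1, (1 - t) * |g t| ^ 2 * weight lam t) =
      ∫ t, (1 - t) * g t * g t ∂weightMeasure lam := by
  rw [integral_weightMeasure]
  simp only [sq_abs]
  simp only [pow_two, mul_assoc]

lemma tendsto_sum_coeff_sq {lam : ℝ} (hlam : -1 / 2 < lam) {f : ℝ → ℝ} (hf : MemL2 lam f)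
    (h0 : coeff lam f 0 = 0) :
    Tendsto (fun N => ∑ n ∈ Finset.range N, coeff lam f (n + 1) ^ 2) atTop
      (𝓝 (normConst lam * ∫ t, f t * f t ∂weightMeasure lam)) := by
  have h := (tendsto_add_atTop_iff_nat 1).2 (parseval hlam hf hf).tendsto_sum_nat
  refine h.congr fun N => ?_
  rw [Finset.sum_range_succ', h0]
  simp [pow_two]

/-- The Hardy–Rellich inequality follows from an inequality for partial sums. -/
lemma hardyRellich_of_partial_sums {lam : ℝ} (hlam : -1 / 2 < lam) (a K B : ℝ)
    (H : ∀ (x : ℕ → ℝ) (N : ℕ), ∑ n ∈ Finset.range N, x n ^ 2 / eigenvalue lam (n + 1) ≤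
      K * ∑ n ∈ Finset.range N, (x n ^ 2 - 2 * jacobi lam (n + 1) * x n * x (n + 1)) +
        B * x N ^ 2) :
    HardyRellich lam a K := by
  intro f g hf hmean hfg
  have hf0 := coeff_zero_of_integral_eq_zero hmean
  have hg0 := hfg.coeff_zero (by norm_num)
  have hc := normConst_pos hlam
  rw [integral_abs_sq, integral_one_sub_abs_sq]
  have h1 := tendsto_sum_coeff_sq hlam hf.1 hf0
  have h2 := tendsto_energy hlam hfg.1 hg0
  -- The coefficients are square summable, so the boundary term `B * x N ^ 2` disappears in the
  -- limit.
  have h3 : Tendsto (fun N => coeff lam g (N + 1) ^ 2) atTop (𝓝 0) := by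
    have h := (tendsto_add_atTop_iff_nat 1).2
      (parseval hlam hfg.1 hfg.1).summable.tendsto_atTop_zero
    simpa [pow_two] using h
  have h4 := (h2.const_mul K).add (h3.const_mul B)
  rw [mul_zero, add_zero] at h4
  have h5 := le_of_tendsto_of_tendsto' h1 h4 fun N => by
    have := H (fun n => coeff lam g (n + 1)) N
    simp only [hfg.coeff_sq hlam] at this
    exact this
  refine le_of_mul_le_mul_left (le_of_le_of_eq h5 ?_) hc
  ring

/-- The Hardy–Rellich inequality, tested on finite expansions. -/
lemma HardyRellich.sum_le {lam : ℝ} (hlam : -1 / 2 < lam) {a K : ℝ}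
    (H : HardyRellich lam a K) {x : ℕ → ℝ} {N : ℕ} (hx : ∀ n, N ≤ n → x n = 0) :
    ∑ n ∈ Finset.range N, x n ^ 2 / eigenvalue lam (n + 1) ≤
      K * ∑ n ∈ Finset.range N, (x n ^ 2 - 2 * jacobi lam (n + 1) * x n * x (n + 1)) := by
  have he0 : eigenvalue lam 0 = 0 := by simp [eigenvalue]
  have hpos : ∀ n, 0 < eigenvalue lam (n + 1) := fun n => eigenvalue_pos hlam (Nat.succ_ne_zero n)
  -- Dividing by the root of the eigenvalue makes the prescribed `x` the coefficients of `g` rather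
  -- than of `f`.
  set y : ℕ → ℝ := fun n => if n = 0 then 0 else x (n - 1) / √(eigenvalue lam n) with hy
  have hy0 : y 0 = 0 := by simp [hy]
  have hys : ∀ n, y (n + 1) = x n / √(eigenvalue lam (n + 1)) := fun n => by simp [hy]
  obtain ⟨f, hf, hfc⟩ := exists_memL2_coeff hlam y (N + 1)
  obtain ⟨g, hg, hgc⟩ :=
    exists_memL2_coeff hlam (fun n => eigenvalue lam n ^ (1 / 2 : ℝ) * y n) (N + 1)
  -- The witness that `f` lies in the Sobolev space of index `a`; a finite expansion does so for
  -- every `a`.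
  obtain ⟨k, hk, hkc⟩ :=
    exists_memL2_coeff hlam (fun n => eigenvalue lam n ^ (a / 2 : ℝ) * y n) (N + 1)
  have hfg : IsFracPow lam (1 / 2) f g := ⟨hg, fun n => by rw [hgc, hfc]; split_ifs <;> simp⟩
  have hfk : IsFracPow lam (a / 2) f k := ⟨hk, fun n => by rw [hkc, hfc]; split_ifs <;> simp⟩
  have hf0 : coeff lam f 0 = 0 := by simp [hfc, hy0]
  have hg0 : coeff lam g 0 = 0 := hfg.coeff_zero (by norm_num)
  have hgx : ∀ n, coeff lam g (n + 1) = x n := by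
    intro n
    rw [hgc]
    split_ifs with h
    · rw [hys, ← Real.sqrt_eq_rpow, mul_div_cancel₀ _ (Real.sqrt_pos.2 (hpos n)).ne']
    · rw [hx n (by omega)]
  have hmean : (∫ t in (-1 : ℝ)..1, f t * weight lam t) = 0 := by
    have h := coeff_eq hlam f 0
    have hc := (Real.sqrt_pos.2 (normConst_pos hlam)).ne'
    have hs := (sqrt_norm_poly_pos hlam 0).ne'
    rw [hf0] at h
    have h2 := (mul_eq_zero.1 h.symm).resolve_left hc
    simp only [orthoPoly, poly_zero, mul_one, eval_C] at h2
    rw [integral_mul_const, integral_weightMeasure] at h2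
    refine (mul_eq_zero.1 h2).resolve_right (inv_ne_zero ?_)
    simpa [poly_zero] using hs
  have key := H f g ⟨hf, k, hfk⟩ hmean hfg
  rw [integral_abs_sq, integral_one_sub_abs_sq] at key
  have h1 := tendsto_sum_coeff_sq hlam hf hf0
  have h2 := tendsto_energy hlam hg hg0
  simp only [hgx] at h2
  simp only [← hfg.coeff_sq hlam, hgx] at h1
  have hstab : ∀ F : ℕ → ℝ, (∀ n, N ≤ n → F n = 0) → ∀ L : ℝ,
      Tendsto (fun M => ∑ n ∈ Finset.range M, F n) atTop (𝓝 L) →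
      L = ∑ n ∈ Finset.range N, F n := by
    intro F hF L hL
    refine tendsto_nhds_unique hL (tendsto_const_nhds.congr' ?_)
    filter_upwards [eventually_ge_atTop N] with M hM
    refine Finset.sum_subset (Finset.range_mono hM) fun n _ hn => hF n ?_
    simpa using hn
  rw [← hstab _ (fun n hn => by simp [hx n hn]) _ h1, ← hstab _ (fun n hn => by simp [hx n hn]) _ h2]
  have := mul_le_mul_of_nonneg_left key (normConst_pos hlam).le
  refine this.trans (le_of_eq ?_)
  ring

/-! ### The discrete Hardy inequality -/

/-- A discrete Hardy inequality for the Gegenbauer Jacobi matrix without its first row and column. -/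
lemma mul_sum_div_eigenvalue_le {lam : ℝ} (hlam : -1 / 2 < lam) {kap : ℝ}
    (h1 : kap / (1 + 2 * lam) ≤ (lam + 1 / 2) / (2 * (1 + lam)))
    (h2 : ∀ n : ℕ, kap / eigenvalue lam (n + 2) ≤
      (lam - 1 / 2) ^ 2 / (2 * (n + 2 + lam) * (n + 3 / 2 + lam))) (x : ℕ → ℝ) (N : ℕ) :
    kap * ∑ n ∈ Finset.range N, x n ^ 2 / eigenvalue lam (n + 1) ≤
      ∑ n ∈ Finset.range N, (x n ^ 2 - 2 * jacobi lam (n + 1) * x n * x (n + 1)) +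
        2 * x N ^ 2 := by
  -- `be n / 2` is the share of the diagonal entry `n` spent on the cross term with `n - 1`. It is
  -- zero at `n = 0`, where the removed first row leaves no left neighbour.
  set be : ℕ → ℝ := fun n => if n = 0 then 0 else
    ((n : ℝ) + 1) * (n + 2 * lam) / ((n + 1 + lam) * (n + lam + 1 / 2)) with hbe
  have hbes : ∀ n : ℕ, be (n + 1) =
      ((n : ℝ) + 2) * (n + 1 + 2 * lam) / ((n + 2 + lam) * (n + 3 / 2 + lam)) := by
    intro n
    simp only [hbe, Nat.succ_ne_zero, if_false]
    push_cast
    congr 1 <;> ring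
  -- The two AM-GM shares leave exactly the right-hand sides of `h1` (for `n = 0`) and `h2` (for `n
  -- ≥ 1`) on the diagonal.
  have hle : ∀ n : ℕ, kap / eigenvalue lam (n + 1) + be n / 2 +
      ((n : ℝ) + 3 / 2 + lam) / (n + 1 + lam) / 2 ≤ 1 := by
    intro n
    rcases n with _ | n
    · have e : eigenvalue lam (0 + 1) = 1 + 2 * lam := by simp [eigenvalue]
      have e2 : (1 : ℝ) - ((0 : ℕ) + 3 / 2 + lam) / ((0 : ℕ) + 1 + lam) / 2 =
          (lam + 1 / 2) / (2 * (1 + lam)) := by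
        have : 1 + lam ≠ 0 := by linarith
        push_cast
        simp only [zero_add]
        field_simp
        ring
      have e3 : be 0 = 0 := by simp [hbe]
      rw [e, e3]
      linarith
    · have hn : (0 : ℝ) ≤ n := Nat.cast_nonneg n
      have e2 : (1 : ℝ) - (((n + 1 : ℕ) : ℝ) + 3 / 2 + lam) / ((n + 1 : ℕ) + 1 + lam) / 2 -
          be (n + 1) / 2 = (lam - 1 / 2) ^ 2 / (2 * (n + 2 + lam) * (n + 3 / 2 + lam)) := by
        have p1 : (n : ℝ) + 2 + lam ≠ 0 := by linarith
        have p1' : (n : ℝ) + 1 + 1 + lam ≠ 0 := by linarith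
        have p2 : (n : ℝ) + 3 / 2 + lam ≠ 0 := by linarith
        have p2' : (n : ℝ) * 2 + 3 + 2 * lam ≠ 0 := by linarith
        rw [hbes]
        push_cast
        field_simp
        ring
      have := h2 n
      linarith
  have hstep : ∀ n : ℕ, ∀ u v : ℝ, 2 * jacobi lam (n + 1) * u * v ≤
      ((n : ℝ) + 3 / 2 + lam) / (n + 1 + lam) / 2 * u ^ 2 + be (n + 1) / 2 * v ^ 2 := by
    intro n u v
    have hn : (0 : ℝ) ≤ n := Nat.cast_nonneg n
    have p0 : 0 < (n : ℝ) + 1 + lam := by linarith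
    have p1 : 0 < (n : ℝ) + 2 + lam := by linarith
    have p2 : 0 < (n : ℝ) + 3 / 2 + lam := by linarith
    have p3 : 0 < (n : ℝ) + 1 + 2 * lam := by linarith
    have hal : 0 < ((n : ℝ) + 3 / 2 + lam) / (n + 1 + lam) := by positivity
    set al := ((n : ℝ) + 3 / 2 + lam) / (n + 1 + lam) with hal'
    have hprod : al * be (n + 1) = 4 * jacobi lam (n + 1) ^ 2 := by
      have p2' : (n : ℝ) * 2 + 3 + 2 * lam ≠ 0 := by linarith
      rw [hal', hbes, jacobi_succ_sq hlam]
      field_simp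
    -- As `al * be (n + 1) = 4 * jacobi lam (n + 1) ^ 2`, the difference times `al` is half a
    -- perfect square.
    have hq : 0 ≤ al * (al / 2 * u ^ 2 + be (n + 1) / 2 * v ^ 2 -
        2 * jacobi lam (n + 1) * u * v) := by
      have : al * (al / 2 * u ^ 2 + be (n + 1) / 2 * v ^ 2 - 2 * jacobi lam (n + 1) * u * v) =
          (al * u - 2 * jacobi lam (n + 1) * v) ^ 2 / 2 := by
        linear_combination v ^ 2 / 2 * hprod
      rw [this]
      positivity
    have := nonneg_of_mul_nonneg_right hq hal
    linarith
  have hmain : kap * ∑ n ∈ Finset.range N, x n ^ 2 / eigenvalue lam (n + 1) ≤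
      ∑ n ∈ Finset.range N, (x n ^ 2 - 2 * jacobi lam (n + 1) * x n * x (n + 1)) +
        be N / 2 * x N ^ 2 := by
    induction N with
    | zero => simp [hbe]
    | succ N ih =>
      rw [Finset.sum_range_succ, Finset.sum_range_succ, mul_add]
      have a1 := hstep N (x N) (x (N + 1))
      have a2 := mul_le_mul_of_nonneg_right (hle N) (sq_nonneg (x N))
      have a3 : kap * (x N ^ 2 / eigenvalue lam (N + 1)) =
        kap / eigenvalue lam (N + 1) * x N ^ 2 := by ring
      rw [a3]
      linarith
  refine hmain.trans ?_
  -- Any bound independent of `N` would do, since the boundary term vanishes in the limit.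
  have hb4 : be N ≤ 4 := by
    rcases N with _ | n
    · simp [hbe]
    · have hn : (0 : ℝ) ≤ n := Nat.cast_nonneg n
      have p1 : 0 < (n : ℝ) + 2 + lam := by linarith
      have p2 : 0 < (n : ℝ) + 3 / 2 + lam := by linarith
      rw [hbes, div_le_iff₀ (by positivity)]
      have : ((n : ℝ) + 2) * (n + 1 + 2 * lam) ≤
        (2 * (n + 2 + lam)) * (2 * (n + 3 / 2 + lam)) := by
        apply mul_le_mul <;> linarith
      linarith
  have := mul_le_mul_of_nonneg_right hb4 (sq_nonneg (x N))
  linarith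

lemma hardyRellich_of_pos {lam : ℝ} (hlam : -1 / 2 < lam) {kap : ℝ} (hk : 0 < kap)
    (h1 : kap / (1 + 2 * lam) ≤ (lam + 1 / 2) / (2 * (1 + lam)))
    (h2 : ∀ n : ℕ, kap / eigenvalue lam (n + 2) ≤
      (lam - 1 / 2) ^ 2 / (2 * (n + 2 + lam) * (n + 3 / 2 + lam))) (a : ℝ) :
    HardyRellich lam a (1 / kap) := by
  refine hardyRellich_of_partial_sums hlam a _ (1 / kap * 2) fun x N => ?_
  have := mul_sum_div_eigenvalue_le hlam h1 h2 x N
  rw [mul_assoc, ← mul_add, one_div, le_inv_mul_iff₀ hk]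
  exact this

lemma exists_hardyRellich {lam : ℝ} (hlam : -1 / 2 < lam) (hne : lam ≠ 1 / 2) :
    ∃ K : ℝ, 0 < K ∧ ∀ a : ℝ, HardyRellich lam a K := by
  have hm : 0 < (lam - 1 / 2) ^ 2 := by
    have := sub_ne_zero.2 hne
    positivity
  set M := 2 * (1 + |lam|) with hM
  have hMpos : 0 < M := by positivity
  have q1 : 0 < 1 + lam := by linarith
  have q2 : 0 < 1 + 2 * lam := by linarith
  have q3 : 0 < lam + 1 / 2 := by linarith
  -- The first entry handles `n ≥ 1` through `hb`, which compares the denominator with `M` times the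
  -- eigenvalue; the second is what the corner `n = 0` allows.
  set kap := min ((lam - 1 / 2) ^ 2 / (2 * M)) ((lam + 1 / 2) / (2 * (1 + lam)) * (1 + 2 * lam))
    with hkap
  have hk : 0 < kap := lt_min (by positivity) (by positivity)
  refine ⟨1 / kap, by positivity, fun a => hardyRellich_of_pos hlam hk ?_ (fun n => ?_) a⟩
  · rw [div_le_iff₀ q2]
    exact min_le_right _ _
  · have hn : (0 : ℝ) ≤ n := Nat.cast_nonneg n
    have p1 : 0 < (n : ℝ) + 2 + lam := by linarith
    have p2 : 0 < (n : ℝ) + 3 / 2 + lam := by linarith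
    have p3 : 0 < (n : ℝ) + 2 + 2 * lam := by linarith
    have hb : ((n : ℝ) + 2 + lam) * (n + 3 / 2 + lam) ≤ M * eigenvalue lam (n + 2) := by
      have e : M * eigenvalue lam (n + 2) =
          (2 * ((n : ℝ) + 2 + 2 * lam)) * ((1 + |lam|) * (n + 2)) := by
        simp only [eigenvalue, hM]
        push_cast
        ring
      rw [e]
      have h3 := le_abs_self lam
      have h4 := abs_nonneg lam
      apply mul_le_mul _ _ p2.le (by linarith)
      · linarith
      · nlinarith
    have he := eigenvalue_pos hlam (Nat.succ_ne_zero (n + 1))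
    calc kap / eigenvalue lam (n + 2) ≤ (lam - 1 / 2) ^ 2 / (2 * M) / eigenvalue lam (n + 2) :=
          div_le_div_of_nonneg_right (min_le_left _ _) he.le
      _ = (lam - 1 / 2) ^ 2 / (2 * (M * eigenvalue lam (n + 2))) := by
          rw [div_div, mul_assoc]
      _ ≤ _ := by
          apply div_le_div_of_nonneg_left hm.le (by positivity)
          linarith

lemma hardyRellich_sharp {lam : ℝ} (h0 : 0 ≤ lam) (h1 : lam ≤ 1) (hne : lam ≠ 1 / 2) (a : ℝ) :
    HardyRellich lam a (8 / (2 * lam - 1) ^ 2) := by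
  have hm : 0 < (lam - 1 / 2) ^ 2 := by
    have := sub_ne_zero.2 hne
    positivity
  have e : 8 / (2 * lam - 1) ^ 2 = 1 / ((lam - 1 / 2) ^ 2 / 2) := by
    rw [one_div_div]
    have : (2 * lam - 1) ^ 2 = 4 * (lam - 1 / 2) ^ 2 := by ring
    rw [this]
    field_simp
    norm_num
  rw [e]
  have hlt : (lam - 1 / 2) ^ 2 ≤ 1 / 4 := by nlinarith
  refine hardyRellich_of_pos (by linarith) (by positivity) ?_ (fun n => ?_) a
  · rw [div_le_div_iff₀ (by linarith) (by linarith)]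
    nlinarith
  · have hn : (0 : ℝ) ≤ n := Nat.cast_nonneg n
    rw [eigenvalue, div_div]
    push_cast
    apply div_le_div_of_nonneg_left hm.le (by positivity)
    nlinarith
/-! ### Sharpness -/

/-- Logarithmic cutoffs. -/
lemma exists_log_cutoff (B : ℝ) : ∃ (phi : ℕ → ℝ) (N : ℕ), (∀ n, 0 ≤ phi n) ∧ (∀ n, phi n ≤ 1) ∧
    (∀ n, N ≤ n → phi n = 0) ∧
    ∑ n ∈ Finset.range N, ((n : ℝ) + 1) * (phi n - phi (n + 1)) ^ 2 ≤ 1 ∧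
    B ≤ ∑ n ∈ Finset.range N, phi n ^ 2 / (n + 1) := by
  set H : ℕ → ℝ := fun n => ∑ k ∈ Finset.range n, 1 / ((k : ℝ) + 1) with hH
  have hdiv : Tendsto H atTop atTop := Real.tendsto_sum_range_one_div_nat_succ_atTop
  have hHs : ∀ n, H (n + 1) = H n + 1 / ((n : ℝ) + 1) := fun n => Finset.sum_range_succ _ _
  have hmono : Monotone H := monotone_nat_of_le_succ fun n => by
    rw [hHs]
    have : 0 < 1 / ((n : ℝ) + 1) := by positivity
    linarith
  have hH0 : ∀ n, 0 ≤ H n := fun n => Finset.sum_nonneg fun k _ => by positivity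
  obtain ⟨M, hM⟩ := (hdiv.eventually_ge_atTop (4 * B)).exists
  obtain ⟨N, hN1, hN2, hMN⟩ := ((hdiv.eventually_ge_atTop 1).and
    ((hdiv.eventually_ge_atTop (2 * H M)).and (eventually_ge_atTop M))).exists
  have hNpos : 0 < H N := by linarith
  -- With a profile linear in the harmonic numbers the energy is exactly `1 / H N`. Below `M` the
  -- cutoff is at least `1/2` because `2 * H M ≤ H N`, so the mass is at least `H M / 4 ≥ B`.
  set phi : ℕ → ℝ := fun n => if n < N then 1 - H n / H N else 0 with hphi
  have hval : ∀ n, n ≤ N → phi n = 1 - H n / H N := by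
    intro n hn
    rcases hn.lt_or_eq with h | rfl
    · simp [hphi, h]
    · simp [hphi, div_self hNpos.ne']
  refine ⟨phi, N, fun n => ?_, fun n => ?_, fun n hn => ?_, ?_, ?_⟩
  · simp only [hphi]
    split_ifs with h
    · rw [sub_nonneg, div_le_one hNpos]
      exact hmono h.le
    · exact le_rfl
  · simp only [hphi]
    split_ifs with h
    · have := div_nonneg (hH0 n) hNpos.le
      linarith
    · exact zero_le_one
  · simp [hphi, not_lt.2 hn]
  · have e : ∀ n ∈ Finset.range N, ((n : ℝ) + 1) * (phi n - phi (n + 1)) ^ 2 =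
        1 / ((n : ℝ) + 1) * (1 / H N ^ 2) := by
      intro n hn
      rw [Finset.mem_range] at hn
      rw [hval n hn.le, hval (n + 1) hn, hHs]
      field_simp
      ring
    rw [Finset.sum_congr rfl e, ← Finset.sum_mul]
    change H N * _ ≤ 1
    rw [mul_one_div, div_le_one (by positivity)]
    nlinarith
  · have hsub : ∑ n ∈ Finset.range M, phi n ^ 2 / ((n : ℝ) + 1) ≤
        ∑ n ∈ Finset.range N, phi n ^ 2 / ((n : ℝ) + 1) :=
      Finset.sum_le_sum_of_subset_of_nonneg (Finset.range_mono hMN) fun n _ _ => by positivity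
    refine le_trans ?_ hsub
    have h1 : ∑ n ∈ Finset.range M, 1 / ((n : ℝ) + 1) * (1 / 4) ≤
        ∑ n ∈ Finset.range M, phi n ^ 2 / ((n : ℝ) + 1) := by
      refine Finset.sum_le_sum fun n hn => ?_
      rw [Finset.mem_range] at hn
      have h2 : 1 / 2 ≤ phi n := by
        rw [hval n (hn.le.trans hMN), le_sub_comm, div_le_iff₀ hNpos]
        have := hmono hn.le
        linarith
      rw [div_mul_div_comm, one_mul, div_le_div_iff₀ (by positivity) (by positivity)]
      have : 1 / 4 ≤ phi n ^ 2 := by nlinarith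
      have hn : (0 : ℝ) ≤ n := Nat.cast_nonneg n
      nlinarith
    rw [← Finset.sum_mul] at h1
    change H M * _ ≤ _ at h1
    linarith

/-- `Γ(n + lam + 3/2)² / (Γ(n + 2) Γ(n + 1 + 2 lam))`, normalized to be `1` at `n = 0`. -/
noncomputable def groundRatio (lam : ℝ) : ℕ → ℝ
  | 0 => 1
  | n + 1 => groundRatio lam n * ((n : ℝ) + 3 / 2 + lam) ^ 2 / ((n + 2) * (n + 1 + 2 * lam))

lemma one_le_groundRatio {lam : ℝ} (h0 : 0 ≤ lam) (n : ℕ) : 1 ≤ groundRatio lam n := by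
  induction n with
  | zero => exact le_rfl
  | succ n ih =>
    rw [groundRatio, one_le_div (by positivity)]
    have h : ((n : ℝ) + 2) * (n + 1 + 2 * lam) ≤ (n + 3 / 2 + lam) ^ 2 := by
      nlinarith [sq_nonneg (lam - 1 / 2)]
    nlinarith [sq_nonneg ((n : ℝ) + 3 / 2 + lam)]

/-- Each factor is at most `1 + 1 / (4 (n + 1) (n + 2))`, because its numerator exceeds its
denominator by `(lam - 1/2)² ≤ 1/4`. The correction `-1 / (n + 1)` lets the induction close; a plain
bound by `2` would not propagate. -/
lemma groundRatio_le {lam : ℝ} (h0 : 0 ≤ lam) (h1 : lam ≤ 1) (n : ℕ) :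
    groundRatio lam n ≤ 2 - 1 / ((n : ℝ) + 1) := by
  induction n with
  | zero => simp [groundRatio]; norm_num
  | succ n ih =>
    have hn : (0 : ℝ) ≤ n := Nat.cast_nonneg n
    have hd : 0 < ((n : ℝ) + 2) * (n + 1 + 2 * lam) := by positivity
    have hratio : ((n : ℝ) + 3 / 2 + lam) ^ 2 / ((n + 2) * (n + 1 + 2 * lam)) ≤
        1 + 1 / (4 * ((n + 1) * (n + 2))) := by
      rw [div_le_iff₀ hd]
      have e : ((n : ℝ) + 3 / 2 + lam) ^ 2 = (n + 2) * (n + 1 + 2 * lam) + (lam - 1 / 2) ^ 2 := by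
        ring
      have e2 : 1 / 4 ≤ 1 / (4 * (((n : ℝ) + 1) * (n + 2))) * ((n + 2) * (n + 1 + 2 * lam)) := by
        rw [one_div_mul_eq_div, div_le_div_iff₀ (by norm_num) (by positivity)]
        nlinarith
      have e3 : (lam - 1 / 2) ^ 2 ≤ 1 / 4 := by nlinarith
      have e4 := add_mul 1 (1 / (4 * (((n : ℝ) + 1) * (n + 2)))) ((n + 2) * (n + 1 + 2 * lam))
      rw [e, e4, one_mul]
      linarith
    rw [groundRatio, mul_div_assoc]
    have hg := one_le_groundRatio h0 n
    calc groundRatio lam n * (((n : ℝ) + 3 / 2 + lam) ^ 2 / ((n + 2) * (n + 1 + 2 * lam)))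
        ≤ (2 - 1 / ((n : ℝ) + 1)) * (1 + 1 / (4 * ((n + 1) * (n + 2)))) :=
          mul_le_mul ih hratio (by positivity) (by linarith)
      _ ≤ 2 - 1 / (((n + 1 : ℕ) : ℝ) + 1) := by
          have e : 2 - 1 / (((n + 1 : ℕ) : ℝ) + 1) -
              (2 - 1 / ((n : ℝ) + 1)) * (1 + 1 / (4 * ((n + 1) * (n + 2)))) =
              1 / (((n : ℝ) + 1) * (n + 2)) * (1 / 2 + 1 / (4 * (n + 1))) := by
            push_cast
            field_simp
            ring
          have : 0 ≤ 1 / (((n : ℝ) + 1) * (n + 2)) * (1 / 2 + 1 / (4 * (n + 1))) := by positivity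
          linarith

lemma groundRatio_le_two {lam : ℝ} (h0 : 0 ≤ lam) (h1 : lam ≤ 1) (n : ℕ) :
    groundRatio lam n ≤ 2 := by
  have := groundRatio_le h0 h1 n
  have : 0 ≤ 1 / ((n : ℝ) + 1) := by positivity
  linarith

/-- The sequence `√((n + 1 + lam) * groundRatio lam n)` is the equality case of every AM-GM step in
`mul_sum_div_eigenvalue_le`. -/
lemma jacobi_mul_ground {lam : ℝ} (h0 : 0 ≤ lam) (n : ℕ) :
    jacobi lam (n + 1) * √((n + 1 + lam) * groundRatio lam n) *
      √((n + 2 + lam) * groundRatio lam (n + 1)) =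
      ((n : ℝ) + 3 / 2 + lam) * groundRatio lam n / 2 := by
  have hlam : -1 / 2 < lam := by linarith
  have hn : (0 : ℝ) ≤ n := Nat.cast_nonneg n
  have g0 : 0 < groundRatio lam n := one_pos.trans_le (one_le_groundRatio h0 n)
  have g1 : 0 < groundRatio lam (n + 1) := one_pos.trans_le (one_le_groundRatio h0 (n + 1))
  have j := jacobi_succ_pos hlam n
  rw [← sq_eq_sq₀ (by positivity) (by positivity), mul_pow, mul_pow, Real.sq_sqrt (by positivity),
    Real.sq_sqrt (by positivity), jacobi_succ_sq hlam, groundRatio]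
  field_simp
  ring

/-- Ground state substitution: replacing `phi n * phi (n + 1)` by half of `phi n ^ 2 + phi (n + 1) ^
2 - (phi n - phi (n + 1)) ^ 2` and telescoping leaves a gradient term and the Hardy density. The
extra term in `phi N ^ 2` on the left makes the telescoping exact. -/
lemma energy_ground_le {lam : ℝ} (h0 : 0 ≤ lam) (h1 : lam ≤ 1) {phi : ℕ → ℝ}
    (hp0 : ∀ n, 0 ≤ phi n) (hp1 : ∀ n, phi n ≤ 1) (N : ℕ) :
    ∑ n ∈ Finset.range N, (((n : ℝ) + 1 + lam) * groundRatio lam n * phi n ^ 2 -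
        (n + 3 / 2 + lam) * groundRatio lam n * phi n * phi (n + 1)) +
      (N + 1 / 2 + lam) * groundRatio lam N * phi N ^ 2 / 2 ≤
    2 - 1 / ((N : ℝ) + 1) + (lam - 1 / 2) ^ 2 / 2 * ∑ n ∈ Finset.range (N + 1),
        ((n : ℝ) + 1 + lam) * groundRatio lam n * phi n ^ 2 / eigenvalue lam (n + 1) +
      5 / 2 * ∑ n ∈ Finset.range N, ((n : ℝ) + 1) * (phi n - phi (n + 1)) ^ 2 := by
  have hsq : ∀ n, phi n ^ 2 ≤ 1 := fun n => pow_le_one₀ (hp0 n) (hp1 n)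
  have hmu : (lam - 1 / 2) ^ 2 ≤ 1 / 4 := by nlinarith
  have hg0 : ∀ n, 0 < groundRatio lam n := fun n => one_pos.trans_le (one_le_groundRatio h0 n)
  induction N with
  | zero =>
    have e : eigenvalue lam (0 + 1) = 1 + 2 * lam := by simp [eigenvalue]
    simp only [Finset.sum_range_zero, zero_add, Finset.sum_range_one, Nat.cast_zero, groundRatio]
    rw [zero_add] at e
    rw [e]
    have : 0 ≤ (lam - 1 / 2) ^ 2 / 2 * ((1 + lam) * 1 * phi 0 ^ 2 / (1 + 2 * lam)) := by positivity
    nlinarith [hsq 0, sq_nonneg (phi 0)]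
  | succ N ih =>
    have hN : (0 : ℝ) ≤ N := Nat.cast_nonneg N
    rw [Finset.sum_range_succ, Finset.sum_range_succ _ (N + 1),
      Finset.sum_range_succ (fun n : ℕ => ((n : ℝ) + 1) * (phi n - phi (n + 1)) ^ 2)]
    have hg2 := groundRatio_le_two h0 h1 N
    have hg2' := groundRatio_le_two h0 h1 (N + 1)
    have hdiff : (N + 3 / 2 + lam) * (groundRatio lam (N + 1) - groundRatio lam N) =
        (lam - 1 / 2) ^ 2 * (groundRatio lam (N + 1) / (N + 3 / 2 + lam)) := by
      have p : (N : ℝ) + 3 / 2 + lam ≠ 0 := by positivity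
      rw [groundRatio]
      field_simp
      ring
    -- Passing to the density `(N + 2 + lam) / eigenvalue` costs an error that telescopes and
    -- accumulates to the bounded `2 - 1 / (N + 1)`.
    have hfrac : 1 / ((N : ℝ) + 3 / 2 + lam) ≤
        ((N : ℝ) + 2 + lam) / eigenvalue lam (N + 2) + 1 / ((N + 1) * (N + 2)) := by
      rw [eigenvalue]
      push_cast
      rw [div_add_div _ _ (by positivity) (by positivity),
        div_le_div_iff₀ (by positivity) (by positivity)]
      have h : 0 ≤ ((N : ℝ) + 2) * ((N + 2) ^ 2 / 2 + lam * (5 / 2 * N + 9 / 2) + lam ^ 2 +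
        lam ^ 2 * (N + 2)) := by positivity
      linarith
    have hA : (lam - 1 / 2) ^ 2 * (groundRatio lam (N + 1) / (N + 3 / 2 + lam)) *
        phi (N + 1) ^ 2 / 2 ≤ (lam - 1 / 2) ^ 2 / 2 * ((N + 2 + lam) * groundRatio lam (N + 1) *
          phi (N + 1) ^ 2 / eigenvalue lam (N + 2)) + 1 / ((N + 1) * (N + 2)) := by
      have hc0 : 0 ≤ (lam - 1 / 2) ^ 2 / 2 * groundRatio lam (N + 1) * phi (N + 1) ^ 2 := by
        have := hg0 (N + 1)
        positivity
      have hc1 : (lam - 1 / 2) ^ 2 / 2 * groundRatio lam (N + 1) * phi (N + 1) ^ 2 ≤ 1 := by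
        have h3 : (lam - 1 / 2) ^ 2 / 2 * groundRatio lam (N + 1) ≤ 1 := by
          nlinarith [hg0 (N + 1), sq_nonneg (lam - 1 / 2)]
        exact mul_le_one₀ h3 (sq_nonneg _) (hsq _)
      have h2 := mul_le_mul_of_nonneg_left hfrac hc0
      have h3 : (lam - 1 / 2) ^ 2 / 2 * groundRatio lam (N + 1) * phi (N + 1) ^ 2 *
          (1 / (((N : ℝ) + 1) * (N + 2))) ≤ 1 / ((N + 1) * (N + 2)) :=
        mul_le_of_le_one_left (by positivity) hc1
      rw [mul_add] at h2
      refine le_trans (le_of_eq ?_) (h2.trans (add_le_add (le_of_eq ?_) h3)) <;> ring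
    -- The constant `5/2` comes from `N + 3/2 + lam ≤ 5/2 (N + 1)` and `groundRatio ≤ 2`, then
    -- halving.
    have hB : ((N : ℝ) + 3 / 2 + lam) * groundRatio lam N * (phi N - phi (N + 1)) ^ 2 / 2 ≤
        5 / 2 * ((N + 1) * (phi N - phi (N + 1)) ^ 2) := by
      have : ((N : ℝ) + 3 / 2 + lam) * groundRatio lam N ≤ (5 / 2 * (N + 1)) * 2 :=
        mul_le_mul (by linarith) hg2 (hg0 N).le (by positivity)
      have := mul_le_mul_of_nonneg_right this (sq_nonneg (phi N - phi (N + 1)))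
      linarith
    have hC : 1 / ((N : ℝ) + 1) - 1 / (N + 2) = 1 / ((N + 1) * (N + 2)) := by
      field_simp
      ring
    have hD := congrArg (fun z => z * phi (N + 1) ^ 2 / 2) hdiff
    have e1 : (N : ℝ) + 1 + 1 = N + 2 := by ring
    push_cast
    rw [e1]
    have e2 : N + 1 + 1 = N + 2 := rfl
    rw [e2]
    linarith

/-- A constant `K` in the Hardy–Rellich inequality satisfies `K (2 lam - 1)² / 8 ≥ 1`. -/
lemma HardyRellich.one_le_mul {lam : ℝ} (h0 : 0 ≤ lam) (h1 : lam ≤ 1) {a K : ℝ}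
    (H : HardyRellich lam a K) : 1 ≤ K * ((lam - 1 / 2) ^ 2 / 2) := by
  have hlam : -1 / 2 < lam := by linarith
  by_contra! hK
  set kap := (lam - 1 / 2) ^ 2 / 2 with hkap
  have hkap0 : 0 ≤ kap := by positivity
  have hP : max K 0 * kap < 1 := by
    rcases max_choice K 0 with h | h <;> rw [h]
    · exact hK
    · simp
  -- The bound `S ≤ K⁺ (9/2 + kap S)` below, with `K⁺ = max K 0` and `9/2 = 2 + 5/2`, caps `S` at
  -- the quotient here. The cutoff is chosen to exceed it; the factor `2` offsets the `1/2` in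
  -- `hS1`.
  obtain ⟨phi, N, hp0, hp1, hpN, hen, hmass⟩ :=
    exists_log_cutoff (2 * (max K 0 * (9 / 2) / (1 - max K 0 * kap) + 1))
  have hg0 : ∀ n, 0 < groundRatio lam n := fun n => one_pos.trans_le (one_le_groundRatio h0 n)
  set x : ℕ → ℝ := fun n => √((n + 1 + lam) * groundRatio lam n) * phi n with hx
  have hxN : ∀ n, N ≤ n → x n = 0 := fun n hn => by simp [hx, hpN n hn]
  have hxsq : ∀ n, x n ^ 2 = ((n : ℝ) + 1 + lam) * groundRatio lam n * phi n ^ 2 := by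
    intro n
    have := hg0 n
    rw [hx, mul_pow, Real.sq_sqrt (by positivity)]
  have hxx : ∀ n, 2 * jacobi lam (n + 1) * x n * x (n + 1) =
      ((n : ℝ) + 3 / 2 + lam) * groundRatio lam n * phi n * phi (n + 1) := by
    intro n
    have h := jacobi_mul_ground h0 n
    have e : ((n + 1 : ℕ) : ℝ) + 1 + lam = n + 2 + lam := by push_cast; ring
    simp only [hx]
    rw [e]
    linear_combination 2 * phi n * phi (n + 1) * h
  have key := H.sum_le hlam hxN
  -- With `kap = 0` the Hardy inequality is positivity of the energy, which permits replacing `K`,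
  -- of unknown sign, by `max K 0`.
  have hnonneg := mul_sum_div_eigenvalue_le hlam (kap := 0)
    (by rw [zero_div]; exact div_nonneg (by linarith) (by linarith))
    (fun n => by rw [zero_div]; positivity) x N
  rw [hxN N le_rfl, zero_mul] at hnonneg
  have hF := energy_ground_le h0 h1 hp0 hp1 N
  rw [Finset.sum_range_succ _ N, hpN N le_rfl] at hF
  simp only [hxx, hxsq] at key hnonneg
  set F := ∑ n ∈ Finset.range N, (((n : ℝ) + 1 + lam) * groundRatio lam n * phi n ^ 2 -
        (n + 3 / 2 + lam) * groundRatio lam n * phi n * phi (n + 1)) with hFdef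
  set S := ∑ n ∈ Finset.range N,
    ((n : ℝ) + 1 + lam) * groundRatio lam n * phi n ^ 2 / eigenvalue lam (n + 1) with hS
  have hF0 : 0 ≤ F := by simpa using hnonneg
  have hF1 : F ≤ 9 / 2 + kap * S := by
    have : 0 ≤ 1 / ((N : ℝ) + 1) := by positivity
    simp only [ne_eq, OfNat.ofNat_ne_zero, not_false_eq_true, zero_pow, mul_zero, zero_div,
      add_zero, ← hkap] at hF
    linarith
  have hS1 : 1 / 2 * ∑ n ∈ Finset.range N, phi n ^ 2 / ((n : ℝ) + 1) ≤ S := by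
    rw [hS, Finset.mul_sum]
    refine Finset.sum_le_sum fun n _ => ?_
    have hn : (0 : ℝ) ≤ n := Nat.cast_nonneg n
    have e : ((n : ℝ) + 1 + lam) * groundRatio lam n * phi n ^ 2 / eigenvalue lam (n + 1) =
        phi n ^ 2 / (n + 1) * (groundRatio lam n * ((n + 1 + lam) / (n + 1 + 2 * lam))) := by
      rw [eigenvalue]
      push_cast
      field_simp
    rw [e, mul_comm]
    refine mul_le_mul_of_nonneg_left ?_ (by positivity)
    have h2 : 1 / 2 ≤ ((n : ℝ) + 1 + lam) / (n + 1 + 2 * lam) := by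
      rw [div_le_div_iff₀ (by norm_num) (by positivity)]
      linarith
    nlinarith [one_le_groundRatio h0 n]
  have hfin : S ≤ max K 0 * (9 / 2 + kap * S) :=
    calc S ≤ K * F := key
      _ ≤ max K 0 * F := mul_le_mul_of_nonneg_right (le_max_left _ _) hF0
      _ ≤ _ := mul_le_mul_of_nonneg_left hF1 (le_max_right _ _)
  have hS2 : max K 0 * (9 / 2) / (1 - max K 0 * kap) + 1 ≤ S := by linarith
  have hd : 0 < 1 - max K 0 * kap := by linarith
  have : S ≤ max K 0 * (9 / 2) / (1 - max K 0 * kap) := by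
    rw [le_div_iff₀ hd]
    linarith
  linarith

end Gegenbauer

theorem mainTheorem3 (lam : ℝ) (hlam : -1 / 2 < lam) :
    (lam ≠ 1 / 2 →
      ∃ K : ℝ, 0 < K ∧ ∀ a ∈ ({1, 2} : Set ℝ), Gegenbauer.HardyRellich lam a K) ∧
    (0 ≤ lam → lam ≤ 1 → lam ≠ 1 / 2 →
      ∀ a ∈ ({1, 2} : Set ℝ),
        IsLeast {K : ℝ | Gegenbauer.HardyRellich lam a K} (8 / (2 * lam - 1) ^ 2)) ∧
    (lam = 1 / 2 →
      ∀ a ∈ ({1, 2} : Set ℝ), ¬ ∃ K : ℝ, Gegenbauer.HardyRellich lam a K) := by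
  refine ⟨fun hne => ?_, fun h0 h1 hne a _ => ⟨?_, fun K hK => ?_⟩, ?_⟩
  · obtain ⟨K, hK, h⟩ := Gegenbauer.exists_hardyRellich hlam hne
    exact ⟨K, hK, fun a _ => h a⟩
  · exact Gegenbauer.hardyRellich_sharp h0 h1 hne a
  · have h := Gegenbauer.HardyRellich.one_le_mul h0 h1 hK
    have : 2 * lam - 1 ≠ 0 := fun h => hne (by linarith)
    rw [div_le_iff₀ (by positivity)]
    linarith
  · rintro rfl a _ ⟨K, hK⟩
    have h := Gegenbauer.HardyRellich.one_le_mul (by norm_num) (by norm_num) hK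
    -- At `lam = 1/2` the factor `(lam - 1/2)²` vanishes and `h` becomes `1 ≤ 0`.
    norm_num at h
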